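/- For integers $N,j\ge 0$ let $$A(N,j)=\sum_{\substack{\ell_0,\dots,\ell_j\ge 0\\ \ell_0+\dots+\ell_j=N}}\ \sum_{\substack{m_0,\dots,m_j\ge 0\\ m_0+\dots+m_j=N}}\ \prod_{r=0}^{j}\binom{\ell_r+m_r}{\ell_r}^2,\qquad \alpha(w,z)=\sum_{N,j\ge 0}A(N,j)\,w^jz^N .$$ For $0<x<1/4$ put $\mathcal Q_1(x;\xi)=(\xi-x(\xi^2+1))^2-4x^2\xi^2$ and $\mathcal Q_2(x,w;\xi)=\mathcal Q_1(x;\xi)-w^2\xi^2$. The roots of $\mathcal Q_1(x;\cdot)$ are $c_1<c_2<d_1<d_2$, where $$c_1=\tfrac{1+2x-\sqrt{1+4x}}{2x},\quad c_2=\tfrac{1-2x-\sqrt{1-4x}}{2x},\quad d_1=\tfrac{1-2x+\sqrt{1-4x}}{2x},\quad d_2=\tfrac{1+2x+\sqrt{1+4x}}{2x}.$$ With principal square roots let $g(x;\xi)=x\sqrt{\xi-c_1}\sqrt{\xi-c_2}\sqrt{d_1-\xi}\sqrt{d_2-\xi}$ for $\xi\in\mathbb C\setminus((-\infty,c_2]\cup[d_1,\infty))$,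 let $\widetilde g(x;\cdot)$ be its continuous extension to $\mathbb C\setminus([c_1,c_2]\cup[d_1,d_2])$, and put $\widetilde g_\pm(x;r)=\lim_{\epsilon\to0^+}\widetilde g(x;r\pm i\epsilon)$. For $x,w>0$ with $4x+w^2<1$ the branch-cut part of $\alpha(w,x^2)$ is $$\mathcal A_2(x,w)=\frac1\pi\int_{c_1}^{c_2}\frac{i\,\widetilde g_+(x;r)-i\,\widetilde g_-(x;r)}{2\,\mathcal Q_2(x,w;r)}\,dr .$$ Let $$\Pi(k;\lambda)=\int_0^1\frac{1}{\sqrt{(1-t^2)(1-k^2t^2)}}\cdot\frac{dt}{1-\lambda t^2}\qquad(0<k<1,\ \lambda<1)$$ be the complete elliptic integral of the third kind. An algebraic function on a non-empty connected open set $D\subseteq\mathbb R^2$ is a real-analytic function $f:D\to\mathbb R$ with $P(u,v,f(u,v))=0$ for all $(u,v)\in D$, for some non-zero polynomial $P$ with real coefficients. A $\Pi$-combination on $D$ is a function $\sum_{i=1}^m\varphi_i\,\Pi(k_i;\lambda_i)$, where $\varphi_i,k_i,\lambda_i$ are algebraic functions on $D$, no $\varphi_i$ is identically zero, $0<k_i<1$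 and $\lambda_i<1$ on $D$; $m$ is its number of terms. **Theorem.** (1) On $D=\{(x,w):x,w>0,\ 4x+w^2<1\}$ the function $\mathcal A_2(x,w)$ is a $\Pi$-combination with at most $4$ terms. (2) For $(x,w)\in D$ the series $\alpha(w,x^2)$ converges absolutely, and $\alpha(w,x^2)-\mathcal A_2(x,w)$ is an algebraic function of $(x,w)$ on $D$. (3) Hence, on $\{(w,z):w,z>0,\ 4\sqrt z+w^2<1\}$, the series $\alpha(w,z)$ converges absolutely and its sum is an algebraic function plus a $\Pi$-combination with at most $4$ terms. -/

import Mathlib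

open Filter Topology

noncomputable section

/-! ### The combinatorial array and its generating function -/

/-- The array `A(N,j)`: the sum over all `ℓ, m : {0,…,j} → ℕ` with `∑ ℓ_r = ∑ m_r = N` of
`∏_r binom(ℓ_r + m_r, ℓ_r)^2`. -/
def pinskyA (N j : ℕ) : ℕ :=
  ∑ l ∈ Finset.Nat.antidiagonalTuple (j + 1) N, ∑ m ∈ Finset.Nat.antidiagonalTuple (j + 1) N,
    ∏ r : Fin (j + 1), (Nat.choose (l r + m r) (l r)) ^ 2

/-- The term of index `(N, j)` of the double series `∑_{N,j} A(N,j) w^j z^N`. -/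
def alphaTerm (w z : ℝ) (n : ℕ × ℕ) : ℝ :=
  (pinskyA n.1 n.2 : ℝ) * w ^ n.2 * z ^ n.1

/-- The generating function `α(w,z) = ∑_{N,j} A(N,j) w^j z^N`. -/
def alphaGF (w z : ℝ) : ℝ := ∑' n : ℕ × ℕ, alphaTerm w z n

/-! ### The two quartics and the branch points -/

/-- `Q₁(x;ξ) = (ξ - x(ξ² + 1))² - 4x²ξ²`. -/
def quarticOne (x : ℝ) (ξ : ℂ) : ℂ := (ξ - x * (ξ ^ 2 + 1)) ^ 2 - 4 * x ^ 2 * ξ ^ 2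

/-- `Q₂(x,w;ξ) = Q₁(x;ξ) - w²ξ²`. -/
def quarticTwo (x w : ℝ) (ξ : ℂ) : ℂ := quarticOne x ξ - w ^ 2 * ξ ^ 2

/-- The smallest root of `Q₁(x;·)`, for `0 < x < 1/4`. -/
def rootCOne (x : ℝ) : ℝ := (1 + 2 * x - √(1 + 4 * x)) / (2 * x)

/-- The second root of `Q₁(x;·)`. -/
def rootCTwo (x : ℝ) : ℝ := (1 - 2 * x - √(1 - 4 * x)) / (2 * x)

/-- The third root of `Q₁(x;·)`. -/
def rootDOne (x : ℝ) : ℝ := (1 - 2 * x + √(1 - 4 * x)) / (2 * x)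

/-- The largest root of `Q₁(x;·)`. -/
def rootDTwo (x : ℝ) : ℝ := (1 + 2 * x + √(1 + 4 * x)) / (2 * x)

/-! ### The analytic continuation of the square root of `Q₁` and its branch-cut integral -/

/-- The slit plane `ℂ \ ((-∞, c₂(x)] ∪ [d₁(x), ∞))`. -/
def slitDomain (x : ℝ) : Set ℂ :=
  {ξ : ℂ | ¬ (ξ.im = 0 ∧ (ξ.re ≤ rootCTwo x ∨ rootDOne x ≤ ξ.re))}

/-- `g(x;ξ) = x √(ξ - c₁) √(ξ - c₂) √(d₁ - ξ) √(d₂ - ξ)` with principal square roots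
(branch cut along the non-positive real axis). -/
def gFun (x : ℝ) (ξ : ℂ) : ℂ :=
  x * Complex.sqrt (ξ - rootCOne x) * Complex.sqrt (ξ - rootCTwo x) *
    Complex.sqrt (rootDOne x - ξ) * Complex.sqrt (rootDTwo x - ξ)

open Classical in
/-- The continuation of `g(x;·)` to `ℂ \ ([c₁,c₂] ∪ [d₁,d₂])`: it agrees with `g` on the slit
plane, and on the rest of the real line it is the limit of `g` from `ℂ \ ℝ`
(its values on the two cuts are irrelevant). -/
def gTilde (x : ℝ) (ξ : ℂ) : ℂ :=
  if ξ ∈ slitDomain x then gFun x ξ else limUnder (𝓝[{ζ : ℂ | ζ.im ≠ 0}] ξ) (gFun x)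

/-- The boundary value of the continuation at `r` from the upper half-plane. -/
def gPlus (x r : ℝ) : ℂ :=
  limUnder (𝓝[>] (0 : ℝ)) (fun ε : ℝ => gTilde x ((r : ℂ) + Complex.I * (ε : ℂ)))

/-- The boundary value of the continuation at `r` from the lower half-plane. -/
def gMinus (x r : ℝ) : ℂ :=
  limUnder (𝓝[>] (0 : ℝ)) (fun ε : ℝ => gTilde x ((r : ℂ) - Complex.I * (ε : ℂ)))

/-- The branch-cut part
`𝒜₂(x,w) = (1/π) ∫_{c₁}^{c₂} (i g₊(x;r) - i g₋(x;r)) / (2 Q₂(x,w;r)) dr`. -/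
def branchCutPart (x w : ℝ) : ℂ :=
  (1 / (Real.pi : ℂ)) * ∫ r in (rootCOne x)..(rootCTwo x),
    (Complex.I * gPlus x r - Complex.I * gMinus x r) / (2 * quarticTwo x w (r : ℂ))

/-! ### Elliptic integrals, algebraic functions -/

/-- The complete elliptic integral of the third kind, with modulus `k` and characteristic `l`. -/
def ellipticPi (k l : ℝ) : ℝ :=
  ∫ t in (0 : ℝ)..1, 1 / √((1 - t ^ 2) * (1 - k ^ 2 * t ^ 2)) * (1 / (1 - l * t ^ 2))

/-- `f` is an algebraic function on `D` (meant for `D` open, connected and non-empty): a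
real-analytic function of the two variables which satisfies a non-trivial polynomial equation
`P(u, v, f(u,v)) = 0` on `D`. -/
def IsAlgebraicFunOn (D : Set (ℝ × ℝ)) (f : ℝ × ℝ → ℝ) : Prop :=
  AnalyticOnNhd ℝ f D ∧
    ∃ P : MvPolynomial (Fin 3) ℝ, P ≠ 0 ∧ ∀ p ∈ D, MvPolynomial.eval ![p.1, p.2, f p] P = 0

/-- On `D`, `f = ∑_{i < m} φ_i Π(k_i; l_i)` with `φ_i`, `k_i`, `l_i` algebraic functions, no
coefficient `φ_i` vanishing identically, and `(k_i, l_i)` in the range `0 < k_i < 1`, `l_i < 1`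
where the integral defining `Π` converges. -/
def IsPiCombinationOn (D : Set (ℝ × ℝ)) (m : ℕ) (f : ℝ × ℝ → ℝ) : Prop :=
  ∃ φ k l : Fin m → ℝ × ℝ → ℝ,
    (∀ i, IsAlgebraicFunOn D (φ i) ∧ IsAlgebraicFunOn D (k i) ∧ IsAlgebraicFunOn D (l i)) ∧
    (∀ i, ∃ p ∈ D, φ i p ≠ 0) ∧
    (∀ i, ∀ p ∈ D, 0 < k i p ∧ k i p < 1 ∧ l i p < 1) ∧
    ∀ p ∈ D, f p = ∑ i, φ i p * ellipticPi (k i p) (l i p)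

/-- The region `x > 0`, `w > 0`, `4x + w² < 1` in the coordinates `(x, w)`. -/
def regionXW : Set (ℝ × ℝ) := {p | 0 < p.1 ∧ 0 < p.2 ∧ 4 * p.1 + p.2 ^ 2 < 1}

/-- The same region in the coordinates `(w, z)`, where `z = x²`. -/
def regionWZ : Set (ℝ × ℝ) := {q | 0 < q.1 ∧ 0 < q.2 ∧ 4 * √q.2 + q.1 ^ 2 < 1}

end

/-!
Put `B(u,v) = ∑ binom(l+m, l)² u^l v^m = 1 / √((1 - u - v)² - 4uv)`. Then `A(N,j)` is the coefficient
of `u^N v^N` in `B^{j+1}`, so on the torus `u = x e^{iθ}`, `v = x e^{-iθ}` the diagonal series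
`α(w, x²)` is the mean value over `θ` of `∑_j w^j B^{j+1} = 1 / (√(s² - 4x²) - w)`, where
`s = 1 - 2x cos θ` (`hasSum_alphaTerm`). Everything converges absolutely because
`w B < 1` at `θ = 0`, where all terms are positive; this is the condition `4x + w² < 1`.

Instead of moving the contour of integration in the plane of `ξ = e^{iθ}`, the integrand is written
as a Cauchy integral in `s`: it has a simple pole at `ρ = √(4x² + w²)` and a cut `[-2x, 2x]`, so

  `1 / (√(s² - 4x²) - w) = (w/ρ) / (s - ρ)`
  `  + (1/π) ∫_{-2x}^{2x} √(4x² - t²) / ((ρ² - t²)(s - t)) dt`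

(`inv_sqrt_sub_eq`), an identity that only needs the Stieltjes transform of the semicircle. Every
simple fraction `1 / (s - c)` has the mean value `1 / √((1 - c)² - 4x²)` by the Poisson integral
(`integral_inv_sub_mul_cos`). The pole therefore contributes the algebraic function `polePart`, and
the cut contributes `cutIntegral` (`mean_inv_sqrt_sub`). The substitution `t = 1 - x (r + 1/r)`
identifies `cutIntegral` with the branch-cut part of the statement (`branchCutPart_eq`).

Finally `cutIntegral` is an integral over a cycle of the curve `y² = (4x² - t²)((1 - t)² - 4x²)` of a
differential with poles over `t = ±ρ`. The fractional linear map taking `-2x, 2x, 1-2x, 1+2x` to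
`0, 1, 1/(4x)², ∞` brings it to Legendre form with modulus `4x`; partial fractions give one integral
of the first kind, i.e. `Π(4x; 0)`, and one of the third kind for each of the two poles
(`cutIntegral_eq`). All coefficients and characteristics are built from `x` and `w` by field
operations and square roots of positive functions, and algebraic functions are closed under these
operations.
-/

/-! ### Algebraic functions form a ring closed under inversion and square roots -/

/-- The ring of functions `D → ℝ` as an algebra over `ℝ[u, v]`, the variables acting as the two
coordinate functions. -/
@[reducible] noncomputable def coordinateAlgebra (D : Set (ℝ × ℝ)) :
    Algebra (MvPolynomial (Fin 2) ℝ) (D → ℝ) :=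
  (MvPolynomial.aeval (R := ℝ) (S₁ := D → ℝ)
    ![fun p : D => p.1.1, fun p : D => p.1.2]).toRingHom.toAlgebra

attribute [local instance] coordinateAlgebra

section algebraic

variable {D : Set (ℝ × ℝ)} {f g : ℝ × ℝ → ℝ}

lemma algebraMap_coordinateAlgebra_apply (q : MvPolynomial (Fin 2) ℝ) (p : D) :
    algebraMap (MvPolynomial (Fin 2) ℝ) (D → ℝ) q p = MvPolynomial.eval ![p.1.1, p.1.2] q := by
  change (MvPolynomial.aeval (R := ℝ) (S₁ := D → ℝ)
    ![fun p : D => p.1.1, fun p : D => p.1.2]) q p = _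
  have h : (Pi.evalAlgHom ℝ (fun _ : D => ℝ) p).comp (MvPolynomial.aeval (R := ℝ) (S₁ := D → ℝ)
      ![fun p : D => p.1.1, fun p : D => p.1.2]) = MvPolynomial.aeval ![p.1.1, p.1.2] := by
    ext i
    fin_cases i <;> simp
  rw [← MvPolynomial.coe_aeval_eq_eval]
  exact DFunLike.congr_fun h q

lemma aeval_coordinateAlgebra_apply (P : Polynomial (MvPolynomial (Fin 2) ℝ)) (p : D) :
    Polynomial.aeval (fun q : D => f q) P p
      = Polynomial.eval (f p) (P.map (MvPolynomial.eval ![p.1.1, p.1.2])) := by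
  have h := Polynomial.hom_eval₂ P (algebraMap (MvPolynomial (Fin 2) ℝ) (D → ℝ))
    (Pi.evalRingHom (fun _ : D => ℝ) p) (fun q : D => f q)
  rw [Polynomial.aeval_def]
  have e : (Pi.evalRingHom (fun _ : D => ℝ) p).comp
      (algebraMap (MvPolynomial (Fin 2) ℝ) (D → ℝ)) = MvPolynomial.eval ![p.1.1, p.1.2] := by
    exact RingHom.ext fun q => algebraMap_coordinateAlgebra_apply q p
  rw [e] at h
  simpa [Polynomial.eval_map] using h

/-- A polynomial relation in three variables is the same as algebraicity over `ℝ[u, v]`. This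
makes the closure properties of algebraic elements of an algebra over a domain available. -/
lemma isAlgebraicFunOn_iff : IsAlgebraicFunOn D f ↔ AnalyticOnNhd ℝ f D ∧
    IsAlgebraic (MvPolynomial (Fin 2) ℝ) (fun p : D => f p) := by
  refine and_congr_right fun _ => ?_
  -- The distinguished variable of `finSuccEquiv` is the first one, whereas `f` comes last.
  let e : MvPolynomial (Fin 3) ℝ ≃ₐ[ℝ] Polynomial (MvPolynomial (Fin 2) ℝ) :=
    (MvPolynomial.renameEquiv ℝ (finRotate 3)).trans (MvPolynomial.finSuccEquiv ℝ 2)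
  have he (P : MvPolynomial (Fin 3) ℝ) (p : D) :
      Polynomial.aeval (fun q : D => f q) (e P) p
        = MvPolynomial.eval ![p.1.1, p.1.2, f p] P := by
    rw [aeval_coordinateAlgebra_apply]
    change Polynomial.eval (f p) (Polynomial.map _ (MvPolynomial.finSuccEquiv ℝ 2
      (MvPolynomial.rename (finRotate 3) P))) = _
    rw [← MvPolynomial.eval_eq_eval_mv_eval', MvPolynomial.eval_rename]
    congr 2
    ext i
    fin_cases i <;> rfl
  constructor
  · rintro ⟨P, hP, h⟩
    exact ⟨e P, by simpa using hP, funext fun p => by simpa [he] using h p p.2⟩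
  · rintro ⟨P, hP, h⟩
    refine ⟨e.symm P, by simpa using hP, fun p hp => ?_⟩
    rw [← he _ ⟨p, hp⟩, e.apply_symm_apply, h]
    rfl

namespace IsAlgebraicFunOn

lemma fst : IsAlgebraicFunOn D Prod.fst := by
  refine isAlgebraicFunOn_iff.2 ⟨fun p _ => analyticAt_fst, ?_⟩
  convert isAlgebraic_algebraMap (A := D → ℝ) (MvPolynomial.X 0 : MvPolynomial (Fin 2) ℝ)
  simp [algebraMap_coordinateAlgebra_apply]

lemma snd : IsAlgebraicFunOn D Prod.snd := by
  refine isAlgebraicFunOn_iff.2 ⟨fun p _ => analyticAt_snd, ?_⟩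
  convert isAlgebraic_algebraMap (A := D → ℝ) (MvPolynomial.X 1 : MvPolynomial (Fin 2) ℝ)
  simp [algebraMap_coordinateAlgebra_apply]

lemma const (c : ℝ) : IsAlgebraicFunOn D (fun _ => c) := by
  refine isAlgebraicFunOn_iff.2 ⟨fun p _ => analyticAt_const, ?_⟩
  convert isAlgebraic_algebraMap (A := D → ℝ) (MvPolynomial.C c : MvPolynomial (Fin 2) ℝ)
  simp [algebraMap_coordinateAlgebra_apply]

lemma add (hf : IsAlgebraicFunOn D f) (hg : IsAlgebraicFunOn D g) :
    IsAlgebraicFunOn D (fun p => f p + g p) := by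
  rw [isAlgebraicFunOn_iff] at *
  exact ⟨hf.1.add hg.1, hf.2.add hg.2⟩

lemma mul (hf : IsAlgebraicFunOn D f) (hg : IsAlgebraicFunOn D g) :
    IsAlgebraicFunOn D (fun p => f p * g p) := by
  rw [isAlgebraicFunOn_iff] at *
  exact ⟨hf.1.mul hg.1, hf.2.mul hg.2⟩

lemma neg (hf : IsAlgebraicFunOn D f) : IsAlgebraicFunOn D (fun p => -f p) := by
  rw [isAlgebraicFunOn_iff] at *
  exact ⟨hf.1.neg, hf.2.neg⟩

lemma sub (hf : IsAlgebraicFunOn D f) (hg : IsAlgebraicFunOn D g) :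
    IsAlgebraicFunOn D (fun p => f p - g p) := by
  simpa only [sub_eq_add_neg] using hf.add hg.neg

lemma pow (hf : IsAlgebraicFunOn D f) : ∀ n : ℕ, IsAlgebraicFunOn D (fun p => f p ^ n)
  | 0 => by simpa only [pow_zero] using const 1
  | n + 1 => by simpa only [pow_succ] using (hf.pow n).mul hf

lemma inv (hf : IsAlgebraicFunOn D f) (h0 : ∀ p ∈ D, f p ≠ 0) :
    IsAlgebraicFunOn D (fun p => (f p)⁻¹) := by
  rw [isAlgebraicFunOn_iff] at *
  refine ⟨hf.1.inv h0, ?_⟩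
  let : Invertible (fun p : D => f p) :=
    ⟨fun p => (f p)⁻¹, funext fun p => inv_mul_cancel₀ (h0 p p.2),
      funext fun p => mul_inv_cancel₀ (h0 p p.2)⟩
  exact hf.2.invOf

lemma div (hf : IsAlgebraicFunOn D f) (hg : IsAlgebraicFunOn D g) (h0 : ∀ p ∈ D, g p ≠ 0) :
    IsAlgebraicFunOn D (fun p => f p / g p) := by
  simpa only [div_eq_mul_inv] using hf.mul (hg.inv h0)

lemma sqrt (hf : IsAlgebraicFunOn D f) (h0 : ∀ p ∈ D, 0 < f p) :
    IsAlgebraicFunOn D (fun p => √(f p)) := by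
  rw [isAlgebraicFunOn_iff] at *
  refine ⟨fun p hp => ?_, IsAlgebraic.of_pow (n := 2) two_pos ?_⟩
  · have hlog : AnalyticAt ℝ (fun q => Real.log (f q)) p :=
      (analyticAt_log (h0 p hp)).comp (hf.1 p hp)
    have h : AnalyticAt ℝ (fun q => Real.exp (Real.log (f q) / 2)) p :=
      (hlog.div_const (c := 2)).rexp
    refine h.congr ?_
    filter_upwards [(hf.1 p hp).continuousAt.eventually (lt_mem_nhds (h0 p hp))] with q hq
    rw [Real.sqrt_eq_rpow, Real.rpow_def_of_pos hq]
    ring_nf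
  · convert hf.2 using 1
    exact funext fun p => Real.sq_sqrt (h0 p p.2).le

end IsAlgebraicFunOn

end algebraic

/-! ### The Poisson integral and the Stieltjes transform of the semicircle -/

open Real in
/-- The mean value of the Poisson kernel with pole at `(c - √(c² - R²)) / R`. -/
lemma integral_inv_sub_mul_cos {c R : ℝ} (hR : 0 < R) (hc : R < c) :
    ∫ φ in (0 : ℝ)..2 * π, 1 / (c - R * cos φ) = 2 * π / √(c ^ 2 - R ^ 2) := by
  have hD : 0 < c ^ 2 - R ^ 2 := by nlinarith
  set D := √(c ^ 2 - R ^ 2) with hDdef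
  have hDpos : 0 < D := Real.sqrt_pos.2 hD
  have hD2 : D ^ 2 = c ^ 2 - R ^ 2 := Real.sq_sqrt hD.le
  have hDc : D < c := by nlinarith
  have hRcD : c - R < D := by nlinarith
  set q := (c - D) / R with hq
  have hq0 : 0 < q := div_pos (by linarith) hR
  have hq1 : q < 1 := by rw [hq, div_lt_one hR]; linarith
  have hqR : q * R = c - D := by rw [hq]; field_simp
  have key2 := (InnerProductSpace.harmonicOnNhd_const (s := Metric.closedBall (0 : ℂ) 1)
    (1 : ℝ)).circleAverage_poissonKernel_smul (w := (q : ℂ)) (by simpa [abs_of_pos hq0] using hq1)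
  rw [Real.circleAverage_def] at key2
  have e : ∀ φ : ℝ, (‖circleMap 0 1 φ - 0‖ ^ 2 - ‖(q : ℂ) - 0‖ ^ 2) /
      ‖(circleMap 0 1 φ - 0) - ((q : ℂ) - 0)‖ ^ 2 = D * (1 / (c - R * cos φ)) := by
    intro φ
    have h1 : ‖circleMap 0 1 φ - (q : ℂ)‖ ^ 2 = 1 + q ^ 2 - 2 * q * cos φ := by
      rw [← Complex.normSq_eq_norm_sq, Complex.normSq_apply]
      simp [circleMap, Complex.exp_ofReal_mul_I_re, Complex.exp_ofReal_mul_I_im]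
      nlinarith [Real.sin_sq_add_cos_sq φ]
    have h2 : 0 < 1 + q ^ 2 - 2 * q * cos φ := by nlinarith [Real.cos_le_one φ]
    have h3 : 0 < c - R * cos φ := by nlinarith [Real.cos_le_one φ]
    simp only [sub_zero, h1]
    simp only [norm_circleMap_zero, Complex.norm_real, Real.norm_eq_abs, abs_of_pos hq0, abs_one]
    rw [mul_one_div, div_eq_div_iff h2.ne' h3.ne']
    have hq2 : q ^ 2 * R = 2 * c * q - R := by
      have : (q * R) * (q * R) = (c - D) * (q * R) := by rw [hqR]
      have h4 : (q ^ 2 * R - (2 * c * q - R)) * R = 0 := by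
        have : q ^ 2 * R * R = (c - D) ^ 2 := by rw [← hqR]; ring
        linear_combination this - 2 * c * hqR + hD2
      have := mul_eq_zero.1 h4
      rcases this with h | h
      · linarith
      · exact absurd h hR.ne'
    have hDq : D = c - q * R := by linarith
    rw [hDq]
    linear_combination (- cos φ) * hq2 + q * hq2
  simp only [poissonKernel, Pi.smul_apply', smul_eq_mul, mul_one, e,
    intervalIntegral.integral_const_mul] at key2
  field_simp at key2 ⊢
  linarith

open Real in
lemma integral_inv_sub_mul_cos_zero_pi {c R : ℝ} (hR : 0 < R) (hc : R < c) :
    ∫ φ in (0 : ℝ)..π, 1 / (c - R * cos φ) = π / √(c ^ 2 - R ^ 2) := by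
  have hpos : ∀ φ : ℝ, 0 < c - R * cos φ := fun φ => by nlinarith [Real.cos_le_one φ]
  have hcont : Continuous fun φ : ℝ => 1 / (c - R * cos φ) :=
    continuous_const.div (by fun_prop) fun φ => (hpos φ).ne'
  have h := integral_inv_sub_mul_cos hR hc
  rw [← intervalIntegral.integral_add_adjacent_intervals (b := π)
    (hcont.intervalIntegrable _ _) (hcont.intervalIntegrable _ _)] at h
  have h2 := intervalIntegral.integral_comp_sub_left (a := 0) (b := π)
    (fun φ : ℝ => 1 / (c - R * cos φ)) (2 * π)
  simp only [cos_two_pi_sub, sub_zero, show 2 * π - π = π by ring] at h2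
  rw [← h2] at h
  have e : 2 * π / √(c ^ 2 - R ^ 2) = 2 * (π / √(c ^ 2 - R ^ 2)) := by ring
  linarith

open Real in
/-- The Stieltjes transform of the semicircle law, after the substitution `t = R cos φ`. -/
lemma integral_sqrt_div_sub {c R : ℝ} (hR : 0 < R) (hc : R < c) :
    ∫ t in (-R)..R, √(R ^ 2 - t ^ 2) / (c - t) = π * (c - √(c ^ 2 - R ^ 2)) := by
  have hpos : ∀ φ : ℝ, 0 < c - R * cos φ := fun φ => by nlinarith [Real.cos_le_one φ]
  have hsub := intervalIntegral.integral_comp_mul_deriv'' (a := 0) (b := π)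
    (f := fun φ => R * cos φ) (f' := fun φ => R * (-sin φ))
    (g := fun t => √(R ^ 2 - t ^ 2) / (c - t)) (by fun_prop)
    (fun φ _ => ((hasDerivAt_cos φ).const_mul R).hasDerivWithinAt) (by fun_prop)
    (by
      refine ContinuousOn.div (by fun_prop) (by fun_prop) ?_
      rintro _ ⟨φ, -, rfl⟩
      exact (hpos φ).ne')
  simp only [cos_zero, cos_pi, mul_one, mul_neg] at hsub
  rw [intervalIntegral.integral_symm, ← hsub, ← intervalIntegral.integral_neg]
  have hD : 0 < c ^ 2 - R ^ 2 := by nlinarith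
  have e : ∀ φ ∈ Set.uIcc 0 π, - -(((fun t => √(R ^ 2 - t ^ 2) / (c - t)) ∘ fun φ => R * cos φ) φ *
      (R * sin φ)) = (c + R * cos φ) - (c ^ 2 - R ^ 2) * (1 / (c - R * cos φ)) := by
    intro φ hφ
    rw [Set.uIcc_of_le pi_pos.le] at hφ
    have hs : √(R ^ 2 - (R * cos φ) ^ 2) = R * sin φ := by
      rw [show R ^ 2 - (R * cos φ) ^ 2 = (R * sin φ) ^ 2 by
        rw [mul_pow, mul_pow, sin_sq]; ring]
      exact Real.sqrt_sq (mul_nonneg hR.le (sin_nonneg_of_mem_Icc hφ))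
    have := (hpos φ).ne'
    simp only [Function.comp, hs]
    field_simp
    rw [sin_sq]
    ring
  have hcont : Continuous fun φ : ℝ => 1 / (c - R * cos φ) :=
    continuous_const.div (by fun_prop) fun φ => (hpos φ).ne'
  rw [intervalIntegral.integral_congr e, intervalIntegral.integral_sub
    (Continuous.intervalIntegrable (by fun_prop) _ _)
    ((hcont.const_mul _).intervalIntegrable _ _), intervalIntegral.integral_const_mul,
    integral_inv_sub_mul_cos_zero_pi hR hc]
  have h3 : ∫ φ in (0 : ℝ)..π, (c + R * cos φ) = π * c := by
    rw [intervalIntegral.integral_add (by simp) (Continuous.intervalIntegrable (by fun_prop) _ _)]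
    simp
  rw [h3]
  have h4 : √(c ^ 2 - R ^ 2) ^ 2 = c ^ 2 - R ^ 2 := Real.sq_sqrt hD.le
  have h5 : 0 < √(c ^ 2 - R ^ 2) := Real.sqrt_pos.2 hD
  field_simp
  linear_combination h4

open Real in
/-- A Cauchy integral representation: as a function of `s`, the left-hand side is analytic off
`[-R, R]` except for a simple pole at `ρ = √(R² + w²)` with residue `w / ρ`. -/
lemma inv_sqrt_sub_eq {R w s : ℝ} (hR : 0 < R) (hw : 0 < w) (hs : √(R ^ 2 + w ^ 2) < s) :
    1 / (√(s ^ 2 - R ^ 2) - w) = w / √(R ^ 2 + w ^ 2) * (1 / (s - √(R ^ 2 + w ^ 2))) +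
      1 / π * ∫ t in (-R)..R, √(R ^ 2 - t ^ 2) / ((R ^ 2 + w ^ 2 - t ^ 2) * (s - t)) := by
  set ρ := √(R ^ 2 + w ^ 2) with hρdef
  have hρ2 : ρ ^ 2 = R ^ 2 + w ^ 2 := Real.sq_sqrt (by positivity)
  have hρ0 : 0 < ρ := Real.sqrt_pos.2 (by positivity)
  have hρR : R < ρ := by nlinarith
  have hsR : R < s := hρR.trans hs
  have hI : ∀ c, R < c → IntervalIntegrable (fun t => √(R ^ 2 - t ^ 2) / (c - t))
      MeasureTheory.volume (-R) R := by
    intro c hc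
    refine ContinuousOn.intervalIntegrable (ContinuousOn.div (by fun_prop) (by fun_prop) ?_)
    intro t ht
    rw [Set.uIcc_of_le (by linarith)] at ht
    linarith [ht.2]
  -- the reflected transform, with its pole at `-ρ`
  have hrefl : ∫ t in (-R)..R, √(R ^ 2 - t ^ 2) / (ρ + t) = π * (ρ - w) := by
    have h := intervalIntegral.integral_comp_neg (a := -R) (b := R)
      (fun t => √(R ^ 2 - t ^ 2) / (ρ - t))
    simp only [neg_sq, sub_neg_eq_add, neg_neg] at h
    rw [h, integral_sqrt_div_sub hR hρR, show ρ ^ 2 - R ^ 2 = w ^ 2 by rw [hρ2]; ring,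
      Real.sqrt_sq hw.le]
  have hIr : IntervalIntegrable (fun t => √(R ^ 2 - t ^ 2) / (ρ + t))
      MeasureTheory.volume (-R) R := by
    refine ContinuousOn.intervalIntegrable (ContinuousOn.div (by fun_prop) (by fun_prop) ?_)
    intro t ht
    rw [Set.uIcc_of_le (by linarith)] at ht
    linarith [ht.1]
  have e : ∀ t ∈ Set.uIcc (-R) R, √(R ^ 2 - t ^ 2) / ((R ^ 2 + w ^ 2 - t ^ 2) * (s - t)) =
      (1 / (2 * ρ * (s - ρ))) * (√(R ^ 2 - t ^ 2) / (ρ - t)) +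
      (1 / (2 * ρ * (s + ρ))) * (√(R ^ 2 - t ^ 2) / (ρ + t)) -
      (1 / (s ^ 2 - ρ ^ 2)) * (√(R ^ 2 - t ^ 2) / (s - t)) := by
    intro t ht
    rw [Set.uIcc_of_le (by linarith)] at ht
    have h1 : ρ - t ≠ 0 := by linarith [ht.2]
    have h2 : ρ + t ≠ 0 := by linarith [ht.1]
    have h3 : s - t ≠ 0 := by linarith [ht.2]
    have h4 : s - ρ ≠ 0 := by linarith
    have h5 : s + ρ ≠ 0 := by linarith
    rw [← hρ2, show s ^ 2 - ρ ^ 2 = (s - ρ) * (s + ρ) by ring,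
      show ρ ^ 2 - t ^ 2 = (ρ - t) * (ρ + t) by ring]
    field_simp
    ring
  rw [intervalIntegral.integral_congr e, intervalIntegral.integral_sub
    (((hI ρ hρR).const_mul _).add (hIr.const_mul _)) ((hI s hsR).const_mul _),
    intervalIntegral.integral_add ((hI ρ hρR).const_mul _) (hIr.const_mul _),
    intervalIntegral.integral_const_mul, intervalIntegral.integral_const_mul,
    intervalIntegral.integral_const_mul, hrefl, integral_sqrt_div_sub hR hρR,
    integral_sqrt_div_sub hR hsR, show ρ ^ 2 - R ^ 2 = w ^ 2 by rw [hρ2]; ring,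
    Real.sqrt_sq hw.le]
  have hS : 0 < s ^ 2 - R ^ 2 := by nlinarith
  set S := √(s ^ 2 - R ^ 2)
  have hS2 : S ^ 2 = s ^ 2 - R ^ 2 := Real.sq_sqrt hS.le
  have hS0 : 0 < S := Real.sqrt_pos.2 hS
  have hSw : w < S := by nlinarith
  have h4 : s - ρ ≠ 0 := by linarith
  have h5 : s + ρ ≠ 0 := by linarith
  have h6 : S - w ≠ 0 := by linarith
  have hd : s ^ 2 - ρ ^ 2 = (S - w) * (S + w) := by linear_combination -hS2 - hρ2
  have h7 : S + w ≠ 0 := by linarith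
  have h8 : 1 / (S - w) = (S + w) / (s ^ 2 - ρ ^ 2) := by rw [hd]; field_simp
  rw [h8, show s ^ 2 - ρ ^ 2 = (s - ρ) * (s + ρ) by ring]
  field_simp
  ring

/-! ### The double series of squared binomial coefficients on a torus -/

lemma integral_exp_int_mul (k : ℤ) :
    ∫ θ in (0 : ℝ)..2 * Real.pi, Complex.exp (k * θ * Complex.I)
      = if k = 0 then (2 * Real.pi : ℂ) else 0 := by
  split_ifs with hk
  · simp [hk]
  · have hk' : (k * Complex.I : ℂ) ≠ 0 := by simp [hk]
    have h := integral_exp_mul_complex (a := 0) (b := 2 * Real.pi) hk'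
    have e : ∀ θ : ℝ, (k : ℂ) * θ * Complex.I = k * Complex.I * θ := fun θ => by ring
    simp only [e, h]
    have := Complex.exp_int_mul_two_pi_mul_I k
    rw [show (k * Complex.I * (2 * Real.pi : ℝ) : ℂ) = k * (2 * Real.pi * Complex.I) by
      push_cast; ring, this]
    simp

/-- The term `binom(l+m, l)² u^l v^m` at `u = x e^{iθ}`, `v = x e^{-iθ}`, for `p = (l, m)`. -/
noncomputable def sqChooseTerm (x θ : ℝ) (p : ℕ × ℕ) : ℂ :=
  ((p.1 + p.2).choose p.1 : ℂ) ^ 2 * x ^ (p.1 + p.2) *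
    Complex.exp (((p.1 : ℤ) - (p.2 : ℤ) : ℤ) * θ * Complex.I)

lemma norm_sqChooseTerm {x : ℝ} (hx : 0 ≤ x) (θ : ℝ) (p : ℕ × ℕ) :
    ‖sqChooseTerm x θ p‖ = ((p.1 + p.2).choose p.1 : ℝ) ^ 2 * x ^ (p.1 + p.2) := by
  have : Complex.exp (((p.1 : ℤ) - (p.2 : ℤ) : ℤ) * θ * Complex.I)
      = Complex.exp (((((p.1 : ℤ) - (p.2 : ℤ) : ℤ) : ℝ) * θ : ℝ) * Complex.I) := by
    push_cast; rfl
  rw [sqChooseTerm, norm_mul, this, Complex.norm_exp_ofReal_mul_I]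
  simp [abs_of_nonneg hx]

/-- The diagonal of `(x e^{iφ} + v)^n (e^{i(θ-φ)} + 1)^n` in `φ`. -/
lemma sum_antidiagonal_sqChooseTerm (x θ : ℝ) (n : ℕ) :
    ∑ p ∈ Finset.HasAntidiagonal.antidiagonal n, sqChooseTerm x θ p = ((1 / (2 * Real.pi) *
      ∫ φ in (0 : ℝ)..2 * Real.pi, (2 * x * Real.cos θ + 2 * x * Real.cos φ) ^ n : ℝ) : ℂ) := by
  set v : ℂ := x * Complex.exp (-θ * Complex.I) with hv
  have hint (φ : ℝ) : ((2 * x * Real.cos θ + 2 * x * Real.cos φ : ℝ) : ℂ) ^ n =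
      ∑ p ∈ Finset.HasAntidiagonal.antidiagonal n, ∑ q ∈ Finset.HasAntidiagonal.antidiagonal n,
        ((n.choose p.1 : ℂ) * n.choose q.1 * x ^ p.1 * v ^ p.2 * Complex.exp (q.1 * θ * Complex.I))
          * Complex.exp (((p.1 : ℤ) - (q.1 : ℤ) : ℤ) * φ * Complex.I) := by
    have h1 : ((2 * x * Real.cos θ + 2 * x * Real.cos φ : ℝ) : ℂ) =
        (x * Complex.exp (φ * Complex.I) + v) *
          (Complex.exp (θ * Complex.I) * Complex.exp (-φ * Complex.I) + 1) := by
      have a1 : Complex.exp (φ * Complex.I) * Complex.exp (-φ * Complex.I) = 1 := by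
        rw [← Complex.exp_add]; simp
      have a2 : Complex.exp (θ * Complex.I) * Complex.exp (-θ * Complex.I) = 1 := by
        rw [← Complex.exp_add]; simp
      push_cast [Complex.cos]
      rw [hv]
      linear_combination (-x * Complex.exp (θ * Complex.I)) * a1
        - x * Complex.exp (-φ * Complex.I) * a2
    rw [h1, mul_pow, (Commute.all _ _).add_pow', (Commute.all _ _).add_pow', Finset.sum_mul_sum]
    refine Finset.sum_congr rfl fun p _ => Finset.sum_congr rfl fun q _ => ?_
    have b1 : Complex.exp (((p.1 : ℤ) - (q.1 : ℤ) : ℤ) * φ * Complex.I)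
        = Complex.exp (φ * Complex.I) ^ p.1 * Complex.exp (-φ * Complex.I) ^ q.1 := by
      rw [← Complex.exp_nat_mul, ← Complex.exp_nat_mul, ← Complex.exp_add]
      congr 1; push_cast; ring
    have b2 : Complex.exp (q.1 * θ * Complex.I) = Complex.exp (θ * Complex.I) ^ q.1 := by
      rw [← Complex.exp_nat_mul]; congr 1; ring
    rw [b1, b2, mul_pow, mul_pow, nsmul_eq_mul, nsmul_eq_mul, one_pow]
    ring
  have hI : ((∫ φ in (0 : ℝ)..2 * Real.pi, (2 * x * Real.cos θ + 2 * x * Real.cos φ) ^ n : ℝ) : ℂ)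
      = ∑ p ∈ Finset.HasAntidiagonal.antidiagonal n, ∑ q ∈ Finset.HasAntidiagonal.antidiagonal n,
        ((n.choose p.1 : ℂ) * n.choose q.1 * x ^ p.1 * v ^ p.2 * Complex.exp (q.1 * θ * Complex.I))
          * (if (p.1 : ℤ) - q.1 = 0 then (2 * Real.pi : ℂ) else 0) := by
    rw [← intervalIntegral.integral_ofReal]
    push_cast
    simp only [← integral_exp_int_mul, ← intervalIntegral.integral_const_mul]
    simp_rw [← Complex.ofReal_cos]
    rw [← intervalIntegral.integral_congr (fun φ _ => by
      simpa only [Complex.ofReal_mul, Complex.ofReal_add, Complex.ofReal_ofNat] using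
        (hint φ).symm), intervalIntegral.integral_finsetSum]
    · refine Finset.sum_congr rfl fun p _ => ?_
      rw [intervalIntegral.integral_finsetSum]
      exact fun q _ => Continuous.intervalIntegrable (by fun_prop) _ _
    · exact fun p _ => Continuous.intervalIntegrable (by fun_prop) _ _
  rw [Complex.ofReal_mul, hI, Finset.mul_sum]
  refine Finset.sum_congr rfl fun p hp => ?_
  rw [Finset.sum_eq_single_of_mem p hp]
  · rw [Finset.HasAntidiagonal.mem_antidiagonal] at hp
    have hpi : (Real.pi : ℂ) ≠ 0 := by simp [Real.pi_ne_zero]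
    have c1 : Complex.exp (((p.1 : ℤ) - (p.2 : ℤ) : ℤ) * θ * Complex.I) =
        Complex.exp (p.1 * θ * Complex.I) * Complex.exp (-θ * Complex.I) ^ p.2 := by
      rw [← Complex.exp_nat_mul, ← Complex.exp_add]
      congr 1; push_cast; ring
    rw [sqChooseTerm, hp, c1, hv, mul_pow, ← hp, pow_add]
    simp only [sub_self, if_true]
    push_cast
    field_simp
  · intro q hq hqp
    rw [Finset.HasAntidiagonal.mem_antidiagonal] at hp hq
    rw [if_neg, mul_zero]
    intro h
    exact hqp (Prod.ext (by omega) (by omega))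

lemma summable_norm_sqChooseTerm {x : ℝ} (hx : 0 ≤ x) (hx4 : 4 * x < 1) (θ : ℝ) :
    Summable fun p => ‖sqChooseTerm x θ p‖ := by
  rw [← (Finset.HasAntidiagonal.sigmaAntidiagonalEquivProd (A := ℕ)).summable_iff,
    summable_sigma_of_nonneg fun _ => by exact norm_nonneg _]
  refine ⟨fun n => (hasSum_fintype _).summable, ?_⟩
  refine Summable.of_nonneg_of_le (fun n => tsum_nonneg fun _ => norm_nonneg _) (fun n => ?_)
    (summable_geometric_of_lt_one (by positivity : 0 ≤ 4 * x) hx4)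
  rw [tsum_fintype]
  simp only [Function.comp, Finset.HasAntidiagonal.sigmaAntidiagonalEquivProd_apply]
  rw [Finset.sum_coe_sort (Finset.HasAntidiagonal.antidiagonal n) fun p => ‖sqChooseTerm x θ p‖]
  simp only [norm_sqChooseTerm hx]
  calc ∑ p ∈ Finset.HasAntidiagonal.antidiagonal n, ((p.1 + p.2).choose p.1 : ℝ) ^ 2 * x ^ (p.1 + p.2)
      = (∑ p ∈ Finset.HasAntidiagonal.antidiagonal n, (n.choose p.1 : ℝ) ^ 2) * x ^ n := by
        rw [Finset.sum_mul]
        refine Finset.sum_congr rfl fun p hp => ?_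
        rw [Finset.HasAntidiagonal.mem_antidiagonal.1 hp]
    _ ≤ (∑ p ∈ Finset.HasAntidiagonal.antidiagonal n, (n.choose p.1 : ℝ)) ^ 2 * x ^ n := by
        gcongr
        exact Finset.sum_sq_le_sq_sum_of_nonneg fun _ _ => by positivity
    _ = (4 * x) ^ n := by
        rw [Finset.Nat.sum_antidiagonal_eq_sum_range_succ_mk]
        have : ∑ k ∈ Finset.range n.succ, (n.choose k : ℝ) = 2 ^ n := by
          exact_mod_cast Nat.sum_range_choose n
        rw [this, mul_pow, ← pow_mul, mul_comm n 2, pow_mul]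
        norm_num

/-- Closed form of the double series on the torus: `1 / √((1 - u - v)² - 4 u v)`. -/
lemma hasSum_sqChooseTerm {x : ℝ} (hx : 0 < x) (hx4 : 4 * x < 1) (θ : ℝ) :
    HasSum (sqChooseTerm x θ)
      ((1 / √((1 - 2 * x * Real.cos θ) ^ 2 - (2 * x) ^ 2) : ℝ) : ℂ) := by
  have hS := (summable_norm_sqChooseTerm hx.le hx4 θ).of_norm
  have hcos (φ : ℝ) : |2 * x * Real.cos θ + 2 * x * Real.cos φ| ≤ 4 * x := by
    rw [abs_le]
    constructor <;> nlinarith [Real.cos_le_one φ, Real.cos_le_one θ, Real.neg_one_le_cos φ,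
      Real.neg_one_le_cos θ]
  have hgeom : HasSum (fun n : ℕ => ∫ φ in (0 : ℝ)..2 * Real.pi,
      (2 * x * Real.cos θ + 2 * x * Real.cos φ) ^ n)
      (∫ φ in (0 : ℝ)..2 * Real.pi, (1 - (2 * x * Real.cos θ + 2 * x * Real.cos φ))⁻¹) := by
    refine intervalIntegral.hasSum_integral_of_dominated_convergence
      (fun n _ => (4 * x) ^ n) (fun n => (by fun_prop : Continuous _).aestronglyMeasurable)
      (fun n => MeasureTheory.ae_of_all _ fun φ _ => ?_) (MeasureTheory.ae_of_all _ fun φ _ =>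
        summable_geometric_of_lt_one (by positivity) hx4) intervalIntegrable_const
      (MeasureTheory.ae_of_all _ fun φ _ => hasSum_geometric_of_abs_lt_one ((hcos φ).trans_lt hx4))
    rw [norm_pow, Real.norm_eq_abs]
    exact pow_le_pow_left₀ (abs_nonneg _) (hcos φ) n
  have hval : ∫ φ in (0 : ℝ)..2 * Real.pi, (1 - (2 * x * Real.cos θ + 2 * x * Real.cos φ))⁻¹
      = 2 * Real.pi / √((1 - 2 * x * Real.cos θ) ^ 2 - (2 * x) ^ 2) := by
    rw [← integral_inv_sub_mul_cos (by positivity) (by nlinarith [Real.cos_le_one θ])]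
    refine intervalIntegral.integral_congr fun φ _ => ?_
    simp only [one_div]
    congr 1; ring
  have hsig := (Finset.HasAntidiagonal.sigmaAntidiagonalEquivProd (A := ℕ)).hasSum_iff.2 hS.hasSum
  have h1 := hsig.sigma fun n => hasSum_fintype _
  have h2 : (fun n : ℕ => ∑ p : Finset.HasAntidiagonal.antidiagonal n,
      (sqChooseTerm x θ ∘ Finset.HasAntidiagonal.sigmaAntidiagonalEquivProd) ⟨n, p⟩) = fun n : ℕ =>
      ((1 / (2 * Real.pi) * ∫ φ in (0 : ℝ)..2 * Real.pi,
        (2 * x * Real.cos θ + 2 * x * Real.cos φ) ^ n : ℝ) : ℂ) := by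
    funext n
    rw [← sum_antidiagonal_sqChooseTerm]
    simp only [Function.comp, Finset.HasAntidiagonal.sigmaAntidiagonalEquivProd_apply]
    exact Finset.sum_coe_sort (Finset.HasAntidiagonal.antidiagonal n) fun p => sqChooseTerm x θ p
  rw [h2] at h1
  have h3 := (Complex.hasSum_ofReal (f := fun n : ℕ => 1 / (2 * Real.pi) *
    ∫ φ in (0 : ℝ)..2 * Real.pi, (2 * x * Real.cos θ + 2 * x * Real.cos φ) ^ n)).2
      (hgeom.mul_left (1 / (2 * Real.pi)))
  have h4 := h1.unique h3
  rw [hval] at h4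
  refine (hS.hasSum_iff.2 (h4.trans ?_))
  congr 1
  have := Real.pi_ne_zero
  field_simp

/-- The power of an absolutely convergent series, as a series over tuples of indices. -/
lemma hasSum_pow_fin {β : Type*} {g : β → ℂ} {b : ℂ} (hg : HasSum g b)
    (hn : Summable fun i => ‖g i‖) (n : ℕ) :
    (Summable fun f : Fin n → β => ‖∏ r, g (f r)‖) ∧
      HasSum (fun f : Fin n → β => ∏ r, g (f r)) (b ^ n) := by
  induction n with
  | zero =>
    refine ⟨(hasSum_fintype _).summable, ?_⟩
    convert hasSum_fintype (fun f : Fin 0 → β => ∏ r, g (f r)) using 1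
    simp
  | succ n ih =>
    have e : (fun f : Fin (n + 1) → β => ∏ r, g (f r)) ∘ Fin.consEquiv (fun _ => β)
        = fun p : β × (Fin n → β) => g p.1 * ∏ r, g (p.2 r) := by
      funext p
      simp [Fin.prod_univ_succ, Fin.consEquiv]
    have hs := summable_mul_of_summable_norm hn ih.1
    constructor
    · have h : Summable fun p : β × (Fin n → β) => ‖g p.1 * ∏ r, g (p.2 r)‖ :=
        Summable.mul_norm (f := g) (g := fun f : Fin n → β => ∏ r, g (f r)) hn ih.1
      have e' : (fun f : Fin (n + 1) → β => ‖∏ r, g (f r)‖) ∘ Fin.consEquiv (fun _ => β)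
          = fun p : β × (Fin n → β) => ‖g p.1 * ∏ r, g (p.2 r)‖ :=
        funext fun p => congrArg norm (congr_fun e p)
      rwa [← (Fin.consEquiv fun _ => β).summable_iff, e']
    · have h : HasSum (fun p : β × (Fin n → β) => g p.1 * ∏ r, g (p.2 r)) (b * b ^ n) :=
        HasSum.mul (f := g) (g := fun f : Fin n → β => ∏ r, g (f r)) hg ih.2 hs
      rwa [← (Fin.consEquiv fun _ => β).hasSum_iff, e, pow_succ']

/-! ### The generating function as a mean value over a torus -/

section torus

variable {x w : ℝ}

/-- The summand `w^j ∏_r binom(l_r+m_r, l_r)² u^{l_r} v^{m_r}`, with `u = x e^{iθ}` and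
`v = x e^{-iθ}`, of the expansion of `∑_j w^j B^{j+1}`, where `B = ∑ binom(l+m, l)² u^l v^m`. -/
noncomputable def torusTerm (x w θ : ℝ) (i : Σ j : ℕ, Fin (j + 1) → ℕ × ℕ) : ℂ :=
  (w : ℂ) ^ i.1 * ∏ r, sqChooseTerm x θ (i.2 r)

/-- The mean value of `torusTerm x w` over `θ`. -/
noncomputable def torusMean (x w : ℝ) (i : Σ j : ℕ, Fin (j + 1) → ℕ × ℕ) : ℝ :=
  if ∑ r, (i.2 r).1 = ∑ r, (i.2 r).2 then
    w ^ i.1 * (∏ r, (((i.2 r).1 + (i.2 r).2).choose (i.2 r).1 : ℝ) ^ 2) *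
      (x ^ 2) ^ (∑ r, (i.2 r).1) else 0

lemma torusTerm_eq (θ : ℝ) (i : Σ j : ℕ, Fin (j + 1) → ℕ × ℕ) :
    torusTerm x w θ i = ((w ^ i.1 * (∏ r, (((i.2 r).1 + (i.2 r).2).choose (i.2 r).1 : ℝ) ^ 2) *
      x ^ (∑ r, (i.2 r).1 + ∑ r, (i.2 r).2) : ℝ) : ℂ) * Complex.exp
        (((∑ r, (i.2 r).1 : ℕ) - (∑ r, (i.2 r).2 : ℕ) : ℤ) * θ * Complex.I) := by
  rw [torusTerm]
  simp only [sqChooseTerm, Finset.prod_mul_distrib, ← Complex.exp_sum, Finset.prod_pow_eq_pow_sum,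
    Finset.sum_add_distrib]
  rw [← Finset.sum_mul, ← Finset.sum_mul]
  push_cast
  rw [Finset.sum_sub_distrib]
  ring

lemma integral_torusTerm (i : Σ j : ℕ, Fin (j + 1) → ℕ × ℕ) :
    ∫ θ in (0 : ℝ)..2 * Real.pi, torusTerm x w θ i = ((2 * Real.pi * torusMean x w i : ℝ) : ℂ) := by
  simp only [torusTerm_eq, intervalIntegral.integral_const_mul]
  have h := integral_exp_int_mul ((∑ r, (i.2 r).1 : ℕ) - (∑ r, (i.2 r).2 : ℕ) : ℤ)
  push_cast at h ⊢
  rw [h, torusMean]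
  by_cases h0 : ∑ r, (i.2 r).1 = ∑ r, (i.2 r).2
  · rw [if_pos h0, if_pos (by rw [sub_eq_zero]; exact_mod_cast h0), ← h0]
    push_cast
    ring
  · rw [if_neg h0, if_neg (by rw [sub_eq_zero]; exact_mod_cast h0)]
    simp

lemma lt_sqrt_sub_cos (hx : 0 < x) (h : 4 * x + w ^ 2 < 1) (θ : ℝ) :
    w < √((1 - 2 * x * Real.cos θ) ^ 2 - (2 * x) ^ 2) := by
  refine Real.lt_sqrt_of_sq_lt ?_
  nlinarith [Real.cos_le_one θ, mul_nonneg hx.le (sub_nonneg.2 (Real.cos_le_one θ))]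

lemma hasSum_geometric_inv_sub {S : ℝ} (hw : 0 < w) (hS : w < S) :
    HasSum (fun j : ℕ => w ^ j * (1 / S) ^ (j + 1)) (1 / (S - w)) := by
  have hS0 : 0 < S := hw.trans hS
  have h := (hasSum_geometric_of_lt_one (div_nonneg hw.le hS0.le)
    ((div_lt_one hS0).2 hS)).mul_left (1 / S)
  have e : 1 / S * (1 - w / S)⁻¹ = 1 / (S - w) := by
    have : S - w ≠ 0 := by linarith
    field_simp
  rw [e] at h
  have e2 : (fun j : ℕ => w ^ j * (1 / S) ^ (j + 1)) = fun j => 1 / S * (w / S) ^ j := by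
    funext j
    rw [div_pow, div_pow, one_pow, pow_succ]
    field_simp
  rwa [e2]

lemma summable_norm_torusTerm (hx : 0 < x) (hw : 0 < w) (h : 4 * x + w ^ 2 < 1) (θ : ℝ) :
    Summable fun i => ‖torusTerm x w θ i‖ := by
  have hx4 : 4 * x < 1 := by nlinarith
  set S := √((1 - 2 * x * Real.cos 0) ^ 2 - (2 * x) ^ 2) with hS
  have hp : ∀ p, ‖sqChooseTerm x θ p‖ = ‖sqChooseTerm x 0 p‖ := fun p => by
    rw [norm_sqChooseTerm hx.le, norm_sqChooseTerm hx.le]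
  have hp0 : ∀ p, sqChooseTerm x 0 p = (‖sqChooseTerm x θ p‖ : ℂ) := fun p => by
    rw [norm_sqChooseTerm hx.le, sqChooseTerm]
    simp
  have hpow (n : ℕ) : HasSum (fun f : Fin n → ℕ × ℕ => ∏ r, ‖sqChooseTerm x θ (f r)‖)
      ((1 / S) ^ n) := by
    have := (hasSum_pow_fin (hasSum_sqChooseTerm hx hx4 0)
      (summable_norm_sqChooseTerm hx.le hx4 0) n).2
    simp only [hp0] at this
    exact_mod_cast this
  have hn : ∀ i, ‖torusTerm x w θ i‖ = w ^ i.1 * ∏ r, ‖sqChooseTerm x θ (i.2 r)‖ := fun i => by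
    rw [torusTerm, norm_mul, norm_prod, norm_pow, Complex.norm_real, Real.norm_eq_abs,
      abs_of_pos hw]
  rw [summable_sigma_of_nonneg fun _ => by exact norm_nonneg _]
  simp only [hn]
  refine ⟨fun j => ((hpow (j + 1)).mul_left _).summable, ?_⟩
  simp only [((hpow _).mul_left _).tsum_eq]
  exact (hasSum_geometric_inv_sub hw (lt_sqrt_sub_cos hx h 0)).summable

lemma hasSum_torusTerm (hx : 0 < x) (hw : 0 < w) (h : 4 * x + w ^ 2 < 1) (θ : ℝ) :
    HasSum (torusTerm x w θ)
      ((1 / (√((1 - 2 * x * Real.cos θ) ^ 2 - (2 * x) ^ 2) - w) : ℝ) : ℂ) := by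
  have hx4 : 4 * x < 1 := by nlinarith
  have hs := (summable_norm_torusTerm hx hw h θ).of_norm
  refine hs.hasSum_iff.2 ?_
  have h1 := hs.hasSum.sigma fun j => ((hasSum_pow_fin (hasSum_sqChooseTerm hx hx4 θ)
      (summable_norm_sqChooseTerm hx.le hx4 θ) (j + 1)).2).mul_left ((w : ℂ) ^ j)
  refine h1.unique ?_
  exact_mod_cast (Complex.hasSum_ofReal
    (f := fun j : ℕ => w ^ j * (1 / √((1 - 2 * x * Real.cos θ) ^ 2 - (2 * x) ^ 2)) ^ (j + 1))).2
    (hasSum_geometric_inv_sub hw (lt_sqrt_sub_cos hx h θ))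

lemma hasSum_torusMean (hx : 0 < x) (hw : 0 < w) (h : 4 * x + w ^ 2 < 1) :
    HasSum (torusMean x w) (1 / (2 * Real.pi) * ∫ θ in (0 : ℝ)..2 * Real.pi,
      1 / (√((1 - 2 * x * Real.cos θ) ^ 2 - (2 * x) ^ 2) - w)) := by
  have hnorm : ∀ θ i, ‖torusTerm x w θ i‖ = ‖torusTerm x w 0 i‖ := fun θ i => by
    simp only [torusTerm, norm_mul, norm_prod, norm_sqChooseTerm hx.le]
  have hI : HasSum (fun i => ∫ θ in (0 : ℝ)..2 * Real.pi, torusTerm x w θ i)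
      (∫ θ in (0 : ℝ)..2 * Real.pi,
        ((1 / (√((1 - 2 * x * Real.cos θ) ^ 2 - (2 * x) ^ 2) - w) : ℝ) : ℂ)) := by
    refine intervalIntegral.hasSum_integral_of_dominated_convergence
      (fun i _ => ‖torusTerm x w 0 i‖)
      (fun i => ?_) (fun i => MeasureTheory.ae_of_all _ fun θ _ => (hnorm θ i).le)
      (MeasureTheory.ae_of_all _ fun θ _ => summable_norm_torusTerm hx hw h 0)
      intervalIntegrable_const
      (MeasureTheory.ae_of_all _ fun θ _ => hasSum_torusTerm hx hw h θ)
    simp only [torusTerm_eq]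
    exact (by fun_prop : Continuous _).aestronglyMeasurable
  simp only [integral_torusTerm] at hI
  rw [intervalIntegral.integral_ofReal, Complex.hasSum_ofReal] at hI
  have := hI.mul_left (1 / (2 * Real.pi))
  have hpi := Real.pi_ne_zero
  have e : ∀ i, 1 / (2 * Real.pi) * (2 * Real.pi * torusMean x w i) = torusMean x w i :=
    fun i => by field_simp
  simpa only [e] using this

lemma tsum_fiber_torusMean (n : ℕ × ℕ) :
    ∑' i : (fun i : Σ j : ℕ, Fin (j + 1) → ℕ × ℕ => (∑ r, (i.2 r).1, i.1)) ⁻¹' {n},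
      torusMean x w i = alphaTerm w (x ^ 2) n := by
  obtain ⟨N, j⟩ := n
  let e : (Fin (j + 1) → ℕ) × (Fin (j + 1) → ℕ) ↪ Σ j : ℕ, Fin (j + 1) → ℕ × ℕ :=
    ⟨fun lm => ⟨j, fun r => (lm.1 r, lm.2 r)⟩, fun a b hab => by
      have := congr_fun (sigma_mk_injective hab)
      exact Prod.ext (funext fun r => congrArg Prod.fst (this r))
        (funext fun r => congrArg Prod.snd (this r))⟩
  rw [tsum_subtype _ (torusMean x w), tsum_eq_sum
    (s := (Finset.Nat.antidiagonalTuple (j + 1) N ×ˢ Finset.Nat.antidiagonalTuple (j + 1) N).map e)]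
  · rw [Finset.sum_map, Finset.sum_product, alphaTerm, pinskyA]
    push_cast
    rw [Finset.sum_mul, Finset.sum_mul]
    refine Finset.sum_congr rfl fun l hl => ?_
    rw [Finset.sum_mul, Finset.sum_mul]
    refine Finset.sum_congr rfl fun m hm => ?_
    rw [Finset.Nat.mem_antidiagonalTuple] at hl hm
    have he : e (l, m) = ⟨j, fun r => (l r, m r)⟩ := rfl
    rw [he, Set.indicator_of_mem (by simp [hl]), torusMean]
    simp only [hl, hm, if_true]
    ring
  · rintro ⟨j', f⟩ hf
    by_contra hne
    obtain ⟨hmem, hne'⟩ := Set.indicator_apply_ne_zero.1 hne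
    simp only [Set.mem_preimage, Set.mem_singleton_iff, Prod.mk.injEq] at hmem
    obtain ⟨hN, rfl⟩ := hmem
    refine hf (Finset.mem_map.2 ⟨(fun r => (f r).1, fun r => (f r).2), ?_, rfl⟩)
    have hb : ∑ r, (f r).1 = ∑ r, (f r).2 := by
      by_contra hb
      exact hne' (if_neg hb)
    simp only [Finset.mem_product, Finset.Nat.mem_antidiagonalTuple]
    exact ⟨hN, hb ▸ hN⟩

/-- The diagonal series `∑ A(N,j) w^j x^{2N}` is the mean value over `|u| = x`, `uv = x²`, of
`∑_j w^j B(u,v)^{j+1} = 1 / (√((1 - u - v)² - 4uv) - w)`. -/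
lemma hasSum_alphaTerm (hx : 0 < x) (hw : 0 < w) (h : 4 * x + w ^ 2 < 1) :
    HasSum (alphaTerm w (x ^ 2)) (1 / (2 * Real.pi) * ∫ θ in (0 : ℝ)..2 * Real.pi,
      1 / (√((1 - 2 * x * Real.cos θ) ^ 2 - (2 * x) ^ 2) - w)) := by
  have := (hasSum_torusMean hx hw h).tsum_fiberwise
    (fun i : Σ j : ℕ, Fin (j + 1) → ℕ × ℕ => (∑ r, (i.2 r).1, i.1))
  simpa only [tsum_fiber_torusMean] using this

end torus

/-! ### The pole and the cut of the generating function -/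

/-- The branch-cut part in the coordinate `s = 1 - x (r + 1/r)`, which maps `[c₁, c₂]` onto
`[-2x, 2x]`. -/
noncomputable def cutIntegral (x w : ℝ) : ℝ :=
  1 / Real.pi * ∫ t in (-(2 * x))..(2 * x),
    √((2 * x) ^ 2 - t ^ 2) / (((2 * x) ^ 2 + w ^ 2 - t ^ 2) * √((1 - t) ^ 2 - (2 * x) ^ 2))

section cut

variable {x w : ℝ}

lemma two_mul_lt_sqrt (hw : 0 < w) : 2 * x < √((2 * x) ^ 2 + w ^ 2) :=
  Real.lt_sqrt_of_sq_lt (by nlinarith)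

lemma sqrt_lt_one_sub (h : 4 * x + w ^ 2 < 1) :
    √((2 * x) ^ 2 + w ^ 2) < 1 - 2 * x := by
  rw [Real.sqrt_lt' (by nlinarith)]
  nlinarith

open Real in
/-- The mean value over `θ` of the Cauchy representation `inv_sqrt_sub_eq` at
`s = 1 - 2x cos θ`: every simple fraction in `s` averages to a Poisson integral. -/
lemma mean_inv_sqrt_sub (hx : 0 < x) (hw : 0 < w) (h : 4 * x + w ^ 2 < 1) :
    1 / (2 * π) * ∫ θ in (0 : ℝ)..2 * π, 1 / (√((1 - 2 * x * cos θ) ^ 2 - (2 * x) ^ 2) - w) =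
      w / (√((2 * x) ^ 2 + w ^ 2) * √((1 - √((2 * x) ^ 2 + w ^ 2)) ^ 2 - (2 * x) ^ 2))
        + cutIntegral x w := by
  have hρR := two_mul_lt_sqrt (x := x) hw
  have hρ1 := sqrt_lt_one_sub h
  have hρ2 : √((2 * x) ^ 2 + w ^ 2) ^ 2 = (2 * x) ^ 2 + w ^ 2 := Real.sq_sqrt (by positivity)
  set ρ := √((2 * x) ^ 2 + w ^ 2) with hρ
  have hx2 : 0 < 2 * x := by positivity
  have hx4 : 4 * x < 1 := by nlinarith
  have hs (θ : ℝ) : 1 - 2 * x ≤ 1 - 2 * x * cos θ := by nlinarith [cos_le_one θ]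
  set F : ℝ → ℝ → ℝ := fun θ t =>
    √((2 * x) ^ 2 - t ^ 2) / (((2 * x) ^ 2 + w ^ 2 - t ^ 2) * (1 - 2 * x * cos θ - t)) with hF
  have hden {t : ℝ} (ht : t ∈ Set.Icc (-(2 * x)) (2 * x)) : 0 < (2 * x) ^ 2 + w ^ 2 - t ^ 2 := by
    nlinarith [ht.1, ht.2]
  have hFcont : ContinuousOn F.uncurry (Set.univ ×ˢ Set.Icc (-(2 * x)) (2 * x)) := by
    refine ContinuousOn.div (by fun_prop) (by fun_prop) ?_
    rintro ⟨θ, t⟩ ⟨-, ht⟩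
    exact mul_ne_zero (hden ht).ne' (by have := hs θ; have := ht.2; dsimp only; linarith)
  have hcont1 : Continuous fun θ : ℝ => 1 / (1 - 2 * x * cos θ - ρ) :=
    continuous_const.div (by fun_prop) fun θ => by have := hs θ; linarith
  have hle : -(2 * x) ≤ 2 * x := by linarith
  have hswap : ∫ θ in (0 : ℝ)..2 * π, ∫ t in (-(2 * x))..(2 * x), F θ t =
      ∫ t in (-(2 * x))..(2 * x), ∫ θ in (0 : ℝ)..2 * π, F θ t := by
    refine MeasureTheory.intervalIntegral_intervalIntegral_swap ?_
    refine MeasureTheory.IntegrableOn.mono_set (t := Set.uIcc 0 (2 * π) ×ˢ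
      Set.uIcc (-(2 * x)) (2 * x)) ?_
      (Set.prod_mono Set.uIoc_subset_uIcc Set.uIoc_subset_uIcc)
    refine ContinuousOn.integrableOn_compact (isCompact_uIcc.prod isCompact_uIcc) ?_
    rw [Set.uIcc_of_le hle]
    exact hFcont.mono (Set.prod_mono (Set.subset_univ _) subset_rfl)
  have hinner : ∀ t ∈ Set.uIcc (-(2 * x)) (2 * x), ∫ θ in (0 : ℝ)..2 * π, F θ t =
      2 * π * (√((2 * x) ^ 2 - t ^ 2) /
        (((2 * x) ^ 2 + w ^ 2 - t ^ 2) * √((1 - t) ^ 2 - (2 * x) ^ 2))) := by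
    intro t ht
    rw [Set.uIcc_of_le hle] at ht
    have e : ∀ θ, F θ t = √((2 * x) ^ 2 - t ^ 2) / ((2 * x) ^ 2 + w ^ 2 - t ^ 2) *
        (1 / ((1 - t) - 2 * x * cos θ)) := fun θ => by
      rw [div_mul_div_comm, mul_one]
      simp only [hF]
      congr 2
      ring
    simp only [e]
    rw [intervalIntegral.integral_const_mul, integral_inv_sub_mul_cos hx2 (by linarith [ht.2]),
      div_mul_div_comm, ← mul_div_assoc, mul_comm]
  have hInt2 : IntervalIntegrable (fun θ => ∫ t in (-(2 * x))..(2 * x), F θ t)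
      MeasureTheory.volume 0 (2 * π) := by
    refine Continuous.intervalIntegrable ?_ _ _
    have : (fun θ => ∫ t in (-(2 * x))..(2 * x), F θ t) = fun θ =>
        π * (1 / (√((1 - 2 * x * cos θ) ^ 2 - (2 * x) ^ 2) - w)
          - w / ρ * (1 / (1 - 2 * x * cos θ - ρ))) := by
      funext θ
      have := inv_sqrt_sub_eq hx2 hw (s := 1 - 2 * x * cos θ) (by have := hs θ; linarith)
      rw [this]
      simp only [← hρ, hF]
      field_simp
      ring
    rw [this]
    refine continuous_const.mul (Continuous.sub ?_ (continuous_const.mul hcont1))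
    exact continuous_const.div (by fun_prop) fun θ =>
      (sub_pos.2 (lt_sqrt_sub_cos hx h θ)).ne'
  have hrep : ∀ θ ∈ Set.uIcc 0 (2 * π), 1 / (√((1 - 2 * x * cos θ) ^ 2 - (2 * x) ^ 2) - w) =
      w / ρ * (1 / (1 - 2 * x * cos θ - ρ)) +
        1 / π * ∫ t in (-(2 * x))..(2 * x), F θ t := fun θ _ =>
    inv_sqrt_sub_eq hx2 hw (by have := hs θ; linarith)
  have hpole : ∫ θ in (0 : ℝ)..2 * π, 1 / (1 - 2 * x * cos θ - ρ) =
      2 * π / √((1 - ρ) ^ 2 - (2 * x) ^ 2) := by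
    rw [← integral_inv_sub_mul_cos hx2 (by linarith : 2 * x < 1 - ρ)]
    refine intervalIntegral.integral_congr fun θ _ => ?_
    congr 1; ring
  rw [intervalIntegral.integral_congr hrep, intervalIntegral.integral_add
    ((hcont1.const_mul _).intervalIntegrable _ _) (hInt2.const_mul _),
    intervalIntegral.integral_const_mul, intervalIntegral.integral_const_mul, hpole, hswap,
    intervalIntegral.integral_congr hinner, intervalIntegral.integral_const_mul, cutIntegral]
  have hπ := pi_ne_zero
  rw [mul_add]
  congr 1
  · field_simp
  · field_simp

end cut

/-! ### The boundary values of the continuation on `[c₁, c₂]` -/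

lemma sqrt_ofReal_of_nonneg {a : ℝ} (ha : 0 ≤ a) : Complex.sqrt a = (√a : ℂ) := by
  rw [Complex.sqrt_eq_real_add_ite]
  simp [abs_of_nonneg ha]

lemma sqrt_eq_I_mul_sqrt_neg {z : ℂ} (hz : 0 < z.im) :
    Complex.sqrt z = Complex.I * Complex.sqrt (-z) := by
  rw [Complex.sqrt_eq_real_add_ite, Complex.sqrt_eq_real_add_ite (a := -z)]
  simp only [norm_neg, Complex.neg_re, Complex.neg_im, if_pos hz.le,
    if_neg (by linarith : ¬ 0 ≤ -z.im), sub_neg_eq_add, ← sub_eq_add_neg]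
  linear_combination (√((‖z‖ + z.re) / 2) : ℂ) * Complex.I_mul_I

lemma sqrt_eq_neg_I_mul_sqrt_neg {z : ℂ} (hz : z.im < 0) :
    Complex.sqrt z = -(Complex.I * Complex.sqrt (-z)) := by
  rw [Complex.sqrt_eq_real_add_ite, Complex.sqrt_eq_real_add_ite (a := -z)]
  simp only [norm_neg, Complex.neg_re, Complex.neg_im, if_neg hz.not_ge,
    if_pos (by linarith : 0 ≤ -z.im), sub_neg_eq_add, ← sub_eq_add_neg]
  linear_combination (√((‖z‖ + z.re) / 2) : ℂ) * Complex.I_mul_I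

section boundary

variable {x : ℝ}

lemma rootCOne_pos (hx : 0 < x) : 0 < rootCOne x := by
  refine div_pos ?_ (by positivity)
  have : √(1 + 4 * x) < 1 + 2 * x := by
    rw [Real.sqrt_lt' (by positivity)]; nlinarith
  linarith

lemma rootCOne_add_rootDTwo (hx : 0 < x) : x * (rootCOne x + rootDTwo x) = 1 + 2 * x := by
  rw [rootCOne, rootDTwo]; field_simp; ring

lemma rootCOne_mul_rootDTwo (hx : 0 < x) : rootCOne x * rootDTwo x = 1 := by
  have h : √(1 + 4 * x) ^ 2 = 1 + 4 * x := Real.sq_sqrt (by positivity)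
  rw [rootCOne, rootDTwo]
  generalize √(1 + 4 * x) = s at h ⊢
  field_simp
  linear_combination -h

lemma rootCTwo_add_rootDOne (hx : 0 < x) : x * (rootCTwo x + rootDOne x) = 1 - 2 * x := by
  rw [rootCTwo, rootDOne]; field_simp; ring

lemma rootCTwo_mul_rootDOne (hx : 0 < x) (hx4 : 4 * x < 1) : rootCTwo x * rootDOne x = 1 := by
  have h : √(1 - 4 * x) ^ 2 = 1 - 4 * x := Real.sq_sqrt (by linarith)
  rw [rootCTwo, rootDOne]
  generalize √(1 - 4 * x) = s at h ⊢
  field_simp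
  linear_combination -h

lemma rootCTwo_lt_rootDOne (hx : 0 < x) (hx4 : 4 * x < 1) : rootCTwo x < rootDOne x := by
  have : 0 < √(1 - 4 * x) := Real.sqrt_pos.2 (by linarith)
  rw [rootCTwo, rootDOne]
  gcongr
  linarith

lemma rootCTwo_lt_one (hx : 0 < x) (hx4 : 4 * x < 1) : rootCTwo x < 1 := by
  have h1 := rootCTwo_lt_rootDOne hx hx4
  have h2 := rootCTwo_mul_rootDOne hx hx4
  have h3 := rootCTwo_add_rootDOne hx
  by_contra! h
  nlinarith

lemma rootDOne_lt_rootDTwo (hx : 0 < x) (hx4 : 4 * x < 1) : rootDOne x < rootDTwo x := by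
  have : √(1 - 4 * x) < √(1 + 4 * x) := Real.sqrt_lt_sqrt (by linarith) (by linarith)
  rw [rootDOne, rootDTwo]
  gcongr
  linarith

lemma rootCOne_lt_rootCTwo (hx : 0 < x) (hx4 : 4 * x < 1) : rootCOne x < rootCTwo x := by
  have h1 := rootCTwo_mul_rootDOne hx hx4
  have h2 := rootCOne_mul_rootDTwo hx
  have h3 := rootDOne_lt_rootDTwo hx hx4
  have h4 := rootCOne_pos hx
  have h5 : 0 < rootDOne x := by
    refine div_pos ?_ (by positivity)
    have := Real.sqrt_nonneg (1 - 4 * x)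
    linarith
  by_contra! h
  nlinarith [mul_le_mul_of_nonneg_right h h5.le, mul_lt_mul_of_pos_left h3 h4]

/-- The common absolute value `x √(r - c₁) √(c₂ - r) √(d₁ - r) √(d₂ - r) = √(-Q₁(x;r))` of the
boundary values on `[c₁, c₂]`. -/
noncomputable def boundaryAbs (x r : ℝ) : ℝ :=
  x * √(r - rootCOne x) * √(rootCTwo x - r) * √(rootDOne x - r) * √(rootDTwo x - r)

lemma mem_slitDomain_of_im_ne_zero {ξ : ℂ} (hξ : ξ.im ≠ 0) : ξ ∈ slitDomain x :=
  fun h => hξ h.1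

/-- The principal square root is continuous at every real `a ≥ 0`, including `0`. Hence `√(ξ - c₁)`,
`√(c₂ - ξ)`, `√(d₁ - ξ)`, `√(d₂ - ξ)` are continuous at all points of the closed interval
`[c₁, c₂]`, endpoints included, and only `√(ξ - c₂) = ± i √(c₂ - ξ)` jumps there. -/
lemma tendsto_sqrt_prod (hx : 0 < x) (hx4 : 4 * x < 1) {r : ℝ}
    (hr : r ∈ Set.Icc (rootCOne x) (rootCTwo x)) {ζ : ℝ → ℂ}
    (hζ : Tendsto ζ (𝓝[>] 0) (𝓝 (r : ℂ))) :
    Tendsto (fun ε => x * Complex.sqrt (ζ ε - rootCOne x) * Complex.sqrt (-(ζ ε - rootCTwo x)) *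
      Complex.sqrt (rootDOne x - ζ ε) * Complex.sqrt (rootDTwo x - ζ ε)) (𝓝[>] 0)
      (𝓝 (boundaryAbs x r : ℂ)) := by
  have hd1 := rootCTwo_lt_rootDOne hx hx4
  have hd2 := rootDOne_lt_rootDTwo hx hx4
  have key {a : ℝ} (ha : 0 ≤ a) {η : ℝ → ℂ} (hη : Tendsto η (𝓝[>] 0) (𝓝 (a : ℂ))) :
      Tendsto (fun ε => Complex.sqrt (η ε)) (𝓝[>] 0) (𝓝 (√a : ℂ)) := by
    rw [← sqrt_ofReal_of_nonneg ha]
    exact (Complex.continuousAt_sqrt (Or.inl (by simpa using ha))).tendsto.comp hη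
  rw [boundaryAbs]
  push_cast
  refine (((tendsto_const_nhds.mul (key (by linarith [hr.1]) ?_)).mul
    (key (by linarith [hr.2]) ?_)).mul (key (by linarith [hr.2]) ?_)).mul
    (key (by linarith [hr.2]) ?_)
  · push_cast; exact hζ.sub_const _
  · push_cast
    rw [← neg_sub (r : ℂ)]
    exact (hζ.sub_const _).neg
  · push_cast; exact hζ.const_sub _
  · push_cast; exact hζ.const_sub _

lemma gPlus_eq (hx : 0 < x) (hx4 : 4 * x < 1) {r : ℝ}
    (hr : r ∈ Set.Icc (rootCOne x) (rootCTwo x)) :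
    gPlus x r = Complex.I * boundaryAbs x r := by
  refine Tendsto.limUnder_eq ?_
  have hζ : Tendsto (fun ε : ℝ => (r : ℂ) + Complex.I * (ε : ℂ)) (𝓝[>] 0) (𝓝 (r : ℂ)) := by
    have : Continuous fun ε : ℝ => (r : ℂ) + Complex.I * (ε : ℂ) := by fun_prop
    simpa using (this.tendsto 0).mono_left nhdsWithin_le_nhds
  refine ((tendsto_sqrt_prod hx hx4 hr hζ).const_mul Complex.I).congr' ?_
  filter_upwards [self_mem_nhdsWithin] with ε hε
  have hε' : 0 < ε := hε
  rw [gTilde, if_pos (mem_slitDomain_of_im_ne_zero (by simp [hε'.ne'])), gFun,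
    sqrt_eq_I_mul_sqrt_neg (z := (r : ℂ) + Complex.I * ε - rootCTwo x) (by simpa using hε')]
  ring

lemma gMinus_eq (hx : 0 < x) (hx4 : 4 * x < 1) {r : ℝ}
    (hr : r ∈ Set.Icc (rootCOne x) (rootCTwo x)) :
    gMinus x r = -(Complex.I * boundaryAbs x r) := by
  refine Tendsto.limUnder_eq ?_
  have hζ : Tendsto (fun ε : ℝ => (r : ℂ) - Complex.I * (ε : ℂ)) (𝓝[>] 0) (𝓝 (r : ℂ)) := by
    have : Continuous fun ε : ℝ => (r : ℂ) - Complex.I * (ε : ℂ) := by fun_prop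
    simpa using (this.tendsto 0).mono_left nhdsWithin_le_nhds
  refine ((tendsto_sqrt_prod hx hx4 hr hζ).const_mul Complex.I).neg.congr' ?_
  filter_upwards [self_mem_nhdsWithin] with ε hε
  have hε' : 0 < ε := hε
  rw [gTilde, if_pos (mem_slitDomain_of_im_ne_zero (by simp [hε'.ne'])), gFun,
    sqrt_eq_neg_I_mul_sqrt_neg (z := (r : ℂ) - Complex.I * ε - rootCTwo x) (by simpa using hε')]
  ring

/-- The coordinate `s = 1 - x (r + 1/r)`, for which `Q₁(x;r) = r² (s² - 4x²)`. -/
noncomputable def cutCoord (x r : ℝ) : ℝ := 1 - x * (r + r⁻¹)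

lemma cutCoord_add {r : ℝ} (hx : 0 < x) (hr : 0 < r) :
    cutCoord x r + 2 * x = x * (r - rootCOne x) * (rootDTwo x - r) / r := by
  have h1 := rootCOne_add_rootDTwo hx
  have h2 := rootCOne_mul_rootDTwo hx
  rw [cutCoord]
  field_simp
  linear_combination -r * h1 + x * h2

lemma sub_cutCoord {r : ℝ} (hx : 0 < x) (hx4 : 4 * x < 1) (hr : 0 < r) :
    2 * x - cutCoord x r = x * (rootCTwo x - r) * (rootDOne x - r) / r := by
  have h1 := rootCTwo_add_rootDOne hx
  have h2 := rootCTwo_mul_rootDOne hx hx4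
  rw [cutCoord]
  field_simp
  linear_combination r * h1 - x * h2

lemma boundaryAbs_eq (hx : 0 < x) (hx4 : 4 * x < 1) {r : ℝ}
    (hr : r ∈ Set.Icc (rootCOne x) (rootCTwo x)) :
    boundaryAbs x r = r * √((2 * x) ^ 2 - cutCoord x r ^ 2) := by
  have hr0 : 0 < r := (rootCOne_pos hx).trans_le hr.1
  have hd1 := rootCTwo_lt_rootDOne hx hx4
  have hd2 := rootDOne_lt_rootDTwo hx hx4
  have a1 : 0 ≤ r - rootCOne x := by linarith [hr.1]
  have a2 : 0 ≤ rootCTwo x - r := by linarith [hr.2]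
  have a3 : 0 ≤ rootDOne x - r := by linarith [hr.2]
  have e : (2 * x) ^ 2 - cutCoord x r ^ 2 = (x / r) ^ 2 * ((r - rootCOne x) * (rootCTwo x - r) *
      (rootDOne x - r) * (rootDTwo x - r)) := by
    rw [show (2 * x) ^ 2 - cutCoord x r ^ 2 = (cutCoord x r + 2 * x) * (2 * x - cutCoord x r) by
      ring, cutCoord_add hx hr0, sub_cutCoord hx hx4 hr0]
    field_simp
  rw [e, Real.sqrt_mul (by positivity), Real.sqrt_sq (by positivity),
    Real.sqrt_mul (by positivity), Real.sqrt_mul (by positivity), Real.sqrt_mul a1, boundaryAbs]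
  field_simp

lemma cutCoord_mem_Icc (hx : 0 < x) (hx4 : 4 * x < 1) {r : ℝ}
    (hr : r ∈ Set.Icc (rootCOne x) (rootCTwo x)) :
    cutCoord x r ∈ Set.Icc (-(2 * x)) (2 * x) := by
  have hr0 : 0 < r := (rootCOne_pos hx).trans_le hr.1
  have hd1 := rootCTwo_lt_rootDOne hx hx4
  have hd2 := rootDOne_lt_rootDTwo hx hx4
  have h1 : 0 ≤ cutCoord x r + 2 * x := by
    rw [cutCoord_add hx hr0]
    exact div_nonneg (mul_nonneg (mul_nonneg hx.le (by linarith [hr.1])) (by linarith [hr.2]))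
      hr0.le
  have h2 : 0 ≤ 2 * x - cutCoord x r := by
    rw [sub_cutCoord hx hx4 hr0]
    exact div_nonneg (mul_nonneg (mul_nonneg hx.le (by linarith [hr.2])) (by linarith [hr.2]))
      hr0.le
  constructor <;> linarith

lemma quarticTwo_ofReal {w r : ℝ} (hr : r ≠ 0) :
    quarticTwo x w (r : ℂ) = ((-(r ^ 2 * ((2 * x) ^ 2 + w ^ 2 - cutCoord x r ^ 2)) : ℝ) : ℂ) := by
  rw [quarticTwo, quarticOne]
  norm_cast
  rw [cutCoord]
  field_simp
  ring

lemma sq_sub_pos {s : ℝ} (hx4 : 4 * x < 1) (hs : s ∈ Set.Icc (-(2 * x)) (2 * x)) :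
    0 < (1 - s) ^ 2 - (2 * x) ^ 2 := by
  nlinarith [hs.1, hs.2]

/-- The branch-cut part is real, and `r ↦ s` turns it into `cutIntegral`. -/
lemma branchCutPart_eq {w : ℝ} (hx : 0 < x) (hw : 0 < w) (hx4 : 4 * x < 1) :
    branchCutPart x w = (cutIntegral x w : ℂ) := by
  have hc1 := rootCOne_pos hx
  have hc12 := rootCOne_lt_rootCTwo hx hx4
  have hc2 := rootCTwo_lt_one hx hx4
  have hI : Set.uIcc (rootCOne x) (rootCTwo x) = Set.Icc (rootCOne x) (rootCTwo x) :=
    Set.uIcc_of_le hc12.le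
  have hpos {r : ℝ} (hr : r ∈ Set.Icc (rootCOne x) (rootCTwo x)) : 0 < r := hc1.trans_le hr.1
  have hden {t : ℝ} (ht : t ∈ Set.Icc (-(2 * x)) (2 * x)) : 0 < (2 * x) ^ 2 + w ^ 2 - t ^ 2 := by
    nlinarith [ht.1, ht.2]
  set G : ℝ → ℝ := fun t =>
    √((2 * x) ^ 2 - t ^ 2) / (((2 * x) ^ 2 + w ^ 2 - t ^ 2) * √((1 - t) ^ 2 - (2 * x) ^ 2)) with hG
  have e1 : ∀ r ∈ Set.uIcc (rootCOne x) (rootCTwo x),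
      (Complex.I * gPlus x r - Complex.I * gMinus x r) / (2 * quarticTwo x w (r : ℂ)) =
      (((G ∘ cutCoord x) r * (x * (r⁻¹ ^ 2 - 1)) : ℝ) : ℂ) := by
    intro r hr
    rw [hI] at hr
    have hr0 := hpos hr
    have hr1 : r < 1 := hr.2.trans_lt hc2
    have hs := cutCoord_mem_Icc hx hx4 hr
    have hd := hden hs
    have hq : √((1 - cutCoord x r) ^ 2 - (2 * x) ^ 2) = x * (r⁻¹ - r) := by
      rw [← Real.sqrt_sq (mul_nonneg hx.le (sub_nonneg.2 (hr1.le.trans (one_le_inv₀ hr0 |>.2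
        hr1.le)))), cutCoord]
      congr 1
      field_simp
      ring
    rw [gPlus_eq hx hx4 hr, gMinus_eq hx hx4 hr, quarticTwo_ofReal hr0.ne',
      boundaryAbs_eq hx hx4 hr]
    have e : Complex.I * (Complex.I * ((r * √((2 * x) ^ 2 - cutCoord x r ^ 2) : ℝ) : ℂ)) -
        Complex.I * -(Complex.I * ((r * √((2 * x) ^ 2 - cutCoord x r ^ 2) : ℝ) : ℂ)) =
        ((-(2 * (r * √((2 * x) ^ 2 - cutCoord x r ^ 2))) : ℝ) : ℂ) := by
      push_cast
      linear_combination (2 * r * (√((2 * x) ^ 2 - cutCoord x r ^ 2) : ℂ)) * Complex.I_mul_I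
    rw [e]
    norm_cast
    simp only [hG, Function.comp, hq]
    have h3 : r⁻¹ - r ≠ 0 := by
      have := one_lt_inv₀ hr0 |>.2 hr1
      linarith
    have h4 : r⁻¹ ^ 2 - 1 = (r⁻¹ - r) * r⁻¹ := by field_simp
    rw [h4]
    generalize √((2 * x) ^ 2 - cutCoord x r ^ 2) = A
    generalize (2 * x) ^ 2 + w ^ 2 - cutCoord x r ^ 2 = B at hd
    generalize r⁻¹ - r = C at h3
    field_simp
  have hderiv : ∀ r, 0 < r → HasDerivAt (cutCoord x) (x * (r⁻¹ ^ 2 - 1)) r := by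
    intro r hr
    have h := (((hasDerivAt_id r).add (hasDerivAt_inv hr.ne')).const_mul x).const_sub 1
    refine h.congr_deriv ?_
    rw [inv_pow]; ring
  have hsub := intervalIntegral.integral_comp_mul_deriv'' (a := rootCOne x) (b := rootCTwo x)
    (f := cutCoord x) (f' := fun r => x * (r⁻¹ ^ 2 - 1)) (g := G)
    (fun r hr => (hderiv r (hpos (hI ▸ hr))).continuousAt.continuousWithinAt)
    (fun r hr => (hderiv r (by
      rw [min_eq_left hc12.le] at hr; exact hc1.trans hr.1)).hasDerivWithinAt)
    (by
      refine continuousOn_const.mul (ContinuousOn.sub (ContinuousOn.pow (ContinuousOn.inv₀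
        continuousOn_id fun r hr => ?_) 2) continuousOn_const)
      exact (hpos (hI ▸ hr)).ne')
    (by
      refine ContinuousOn.mono (s := Set.Icc (-(2 * x)) (2 * x)) ?_ ?_
      · refine ContinuousOn.div (by fun_prop) (by fun_prop) fun t ht => ?_
        exact mul_ne_zero (hden ht).ne' (Real.sqrt_pos.2 (sq_sub_pos hx4 ht)).ne'
      · rintro _ ⟨r, hr, rfl⟩
        exact cutCoord_mem_Icc hx hx4 (hI ▸ hr))
  have hend1 : cutCoord x (rootCOne x) = -(2 * x) := by
    have := cutCoord_add hx hc1
    rw [sub_self, mul_zero, zero_mul, zero_div] at this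
    linarith
  have hend2 : cutCoord x (rootCTwo x) = 2 * x := by
    have := sub_cutCoord hx hx4 (hc1.trans hc12)
    rw [sub_self, mul_zero, zero_mul, zero_div] at this
    linarith
  rw [branchCutPart, intervalIntegral.integral_congr e1, intervalIntegral.integral_ofReal, hsub,
    hend1, hend2, cutIntegral]
  push_cast
  rfl

end boundary

/-! ### Reduction to complete elliptic integrals of the third kind -/

lemma intervalIntegrable_ellipticPi {k l : ℝ} (hk0 : 0 ≤ k) (hk1 : k < 1) (hl : l < 1) :
    IntervalIntegrable (fun t => 1 / √((1 - t ^ 2) * (1 - k ^ 2 * t ^ 2)) * (1 / (1 - l * t ^ 2)))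
      MeasureTheory.volume 0 1 := by
  have h1 : IntervalIntegrable (fun t : ℝ => (1 - t) ^ (-(1 / 2) : ℝ))
      MeasureTheory.volume 0 1 := by
    have := (intervalIntegral.intervalIntegrable_rpow' (a := 0) (b := 1) (r := -(1 / 2))
      (by norm_num)).comp_sub_left 1
    simpa using this.symm
  have hI : Set.uIcc (0 : ℝ) 1 = Set.Icc 0 1 := Set.uIcc_of_le zero_le_one
  have hk {t : ℝ} (ht : t ∈ Set.Icc (0 : ℝ) 1) : 0 < 1 - k ^ 2 * t ^ 2 := by
    have : k * t < 1 := by nlinarith [ht.1, ht.2]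
    have : 0 ≤ k * t := mul_nonneg hk0 ht.1
    nlinarith
  have hlt {t : ℝ} (ht : t ∈ Set.Icc (0 : ℝ) 1) : 0 < 1 - l * t ^ 2 := by
    have h2 : t ^ 2 ≤ 1 := by nlinarith [ht.1, ht.2]
    rcases le_total l 0 with h0 | h0
    · nlinarith [mul_nonneg (neg_nonneg.2 h0) (sq_nonneg t)]
    · nlinarith [mul_le_mul_of_nonneg_left h2 h0]
  have hcont : ContinuousOn (fun t : ℝ => 1 / √((1 + t) * (1 - k ^ 2 * t ^ 2)) *
      (1 / (1 - l * t ^ 2))) (Set.uIcc 0 1) := by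
    rw [hI]
    refine ContinuousOn.mul (ContinuousOn.div (by fun_prop) (by fun_prop) fun t ht => ?_)
      (ContinuousOn.div (by fun_prop) (by fun_prop) fun t ht => (hlt ht).ne')
    exact (Real.sqrt_pos.2 (mul_pos (by linarith [ht.1]) (hk ht))).ne'
  refine (h1.mul_continuousOn hcont).congr ?_
  intro t ht
  replace ht := hI ▸ Set.uIoc_subset_uIcc ht
  have h1t : 0 ≤ 1 - t := by linarith [ht.2]
  dsimp only
  rw [show (1 - t ^ 2) * (1 - k ^ 2 * t ^ 2) = (1 - t) * ((1 + t) * (1 - k ^ 2 * t ^ 2)) by ring,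
    Real.sqrt_mul h1t, Real.rpow_neg h1t, ← Real.sqrt_eq_rpow, one_div (√(1 - t) * _), mul_inv,
    one_div √((1 + t) * _)]
  ring

section reduction

variable {x w : ℝ}

/-- The fractional linear function of `t²` mapping `0, 1, 1/(4x)², ∞` to the branch points
`-2x, 2x, 1-2x, 1+2x` of the elliptic curve `y² = (4x² - s²)((1 - s)² - 4x²)`. -/
noncomputable def legendreCoord (x t : ℝ) : ℝ :=
  (4 * x * (1 + 2 * x) * t ^ 2 - 2 * x) / (1 + 4 * x * t ^ 2)

lemma hasDerivAt_legendreCoord (hx : 0 < x) (t : ℝ) :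
    HasDerivAt (legendreCoord x) (8 * x * (1 + 4 * x) * t / (1 + 4 * x * t ^ 2) ^ 2) t := by
  have hp : 1 + 4 * x * t ^ 2 ≠ 0 := by positivity
  have h := ((((hasDerivAt_pow 2 t).const_mul (4 * x * (1 + 2 * x))).sub_const (2 * x)).div
    (((hasDerivAt_pow 2 t).const_mul (4 * x)).const_add 1) hp)
  refine h.congr_deriv ?_
  field_simp
  push_cast
  ring

/-- The characteristic of the elliptic integral with pole at `s = ρ`; the pole at `s = -ρ` has
characteristic `poleChar x (-ρ)`. -/
noncomputable def poleChar (x ρ : ℝ) : ℝ := 4 * x * (1 + 2 * x - ρ) / (ρ + 2 * x)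

/-- The coefficient of the elliptic integral with pole at `s = ρ`, or `s = -ρ` for
`poleCoeff x w (-ρ)`. -/
noncomputable def poleCoeff (x w ρ : ℝ) : ℝ :=
  -(w ^ 2 * (1 + 4 * x)) / (Real.pi * (ρ * (ρ + 2 * x) * (1 + 2 * x - ρ)))

lemma poleChar_lt_one (hx : 0 < x) (hw : 0 < w) :
    poleChar x √((2 * x) ^ 2 + w ^ 2) < 1 := by
  have h := two_mul_lt_sqrt (x := x) hw
  rw [poleChar, div_lt_one (by linarith)]
  nlinarith

lemma poleChar_neg_lt_one (hx : 0 < x) (hw : 0 < w) :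
    poleChar x (-√((2 * x) ^ 2 + w ^ 2)) < 1 := by
  have h := two_mul_lt_sqrt (x := x) hw
  rw [poleChar, div_lt_iff_of_neg (by linarith)]
  nlinarith

/-- Partial fractions for the rational factor `(4x² - s²) / (ρ² - s²)` of the differential. -/
lemma legendre_partial_fractions (hx : 0 < x) {ρ t : ℝ}
    (hρ0 : 2 * x < ρ) (hρ1 : ρ < 1 - 2 * x) (hρ2 : ρ ^ 2 = (2 * x) ^ 2 + w ^ 2)
    (ht : t ∈ Set.Icc (0 : ℝ) 1) :
    2 * (((2 * x) ^ 2 - legendreCoord x t ^ 2) / ((2 * x) ^ 2 + w ^ 2 - legendreCoord x t ^ 2)) =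
      Real.pi * (2 * (1 + 4 * x) / (Real.pi * (1 + 4 * x - w ^ 2)) +
        poleCoeff x w ρ * (1 / (1 - poleChar x ρ * t ^ 2)) +
        poleCoeff x w (-ρ) * (1 / (1 - poleChar x (-ρ) * t ^ 2))) := by
  have hπ := Real.pi_ne_zero
  have ht2 : t ^ 2 ≤ 1 := by nlinarith [ht.1, ht.2]
  have ht0 : 0 ≤ t ^ 2 := sq_nonneg t
  rw [← hρ2, show 1 + 4 * x - w ^ 2 = (1 + 2 * x - ρ) * (1 + 2 * x + ρ) by
    linear_combination hρ2,
    show ρ ^ 2 - legendreCoord x t ^ 2 = (ρ - legendreCoord x t) * (ρ + legendreCoord x t) by ring,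
    show (2 * x) ^ 2 - legendreCoord x t ^ 2 = (2 * x - legendreCoord x t) *
      (2 * x + legendreCoord x t) by ring]
  have p0 : 1 + 4 * x * t ^ 2 ≠ 0 := by positivity
  have p1 : ρ + 2 * x - 4 * x * (1 + 2 * x - ρ) * t ^ 2 ≠ 0 := by
    have : 4 * x * (1 + 2 * x - ρ) * t ^ 2 ≤ 4 * x * (1 + 2 * x - ρ) * 1 :=
      mul_le_mul_of_nonneg_left ht2 (mul_nonneg (by linarith) (by linarith))
    nlinarith
  have p2 : ρ - 2 * x + 4 * x * (1 + 2 * x + ρ) * t ^ 2 ≠ 0 := by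
    have : 0 ≤ 4 * x * (1 + 2 * x + ρ) * t ^ 2 :=
      mul_nonneg (mul_nonneg (by linarith) (by linarith)) ht0
    linarith
  have q1 : ρ - legendreCoord x t =
      (ρ + 2 * x - 4 * x * (1 + 2 * x - ρ) * t ^ 2) / (1 + 4 * x * t ^ 2) := by
    rw [legendreCoord]; field_simp; ring
  have q2 : ρ + legendreCoord x t =
      (ρ - 2 * x + 4 * x * (1 + 2 * x + ρ) * t ^ 2) / (1 + 4 * x * t ^ 2) := by
    rw [legendreCoord]; field_simp; ring
  have q3 : 2 * x - legendreCoord x t = 4 * x * (1 - t ^ 2) / (1 + 4 * x * t ^ 2) := by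
    rw [legendreCoord]; field_simp; ring
  have q4 : 2 * x + legendreCoord x t = 4 * x * (1 + 4 * x) * t ^ 2 / (1 + 4 * x * t ^ 2) := by
    rw [legendreCoord]; field_simp; ring
  have r1 : ρ + 2 * x ≠ 0 := by linarith
  have r2 : ρ - 2 * x ≠ 0 := by linarith
  have r3 : 1 + 2 * x - ρ ≠ 0 := by linarith
  have r4 : 1 + 2 * x + ρ ≠ 0 := by linarith
  have r5 : ρ ≠ 0 := by linarith
  have s1 : 1 - poleChar x ρ * t ^ 2 =
      (ρ + 2 * x - 4 * x * (1 + 2 * x - ρ) * t ^ 2) / (ρ + 2 * x) := by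
    rw [poleChar, div_mul_eq_mul_div, one_sub_div r1]
  have s2 : 1 - poleChar x (-ρ) * t ^ 2 =
      (ρ - 2 * x + 4 * x * (1 + 2 * x + ρ) * t ^ 2) / (ρ - 2 * x) := by
    rw [poleChar, sub_neg_eq_add, show -ρ + 2 * x = -(ρ - 2 * x) by ring, div_neg, neg_mul,
      sub_neg_eq_add, div_mul_eq_mul_div, one_add_div r2]
  have s3 : poleCoeff x w (-ρ) = -(w ^ 2 * (1 + 4 * x)) /
      (Real.pi * (ρ * (ρ - 2 * x) * (1 + 2 * x + ρ))) := by
    rw [poleCoeff]; congr 1; ring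
  rw [s1, s2, s3, q1, q2, q3, q4, poleCoeff,
    show w ^ 2 = (ρ - 2 * x) * (ρ + 2 * x) by linear_combination -hρ2]
  generalize hA : ρ + 2 * x - 4 * x * (1 + 2 * x - ρ) * t ^ 2 = A at p1
  generalize hB : ρ - 2 * x + 4 * x * (1 + 2 * x + ρ) * t ^ 2 = B at p2
  generalize 1 + 4 * x * t ^ 2 = P at p0
  generalize ha : ρ + 2 * x = a at r1
  generalize hb : ρ - 2 * x = b at r2
  generalize hc : 1 + 2 * x - ρ = c at r3
  generalize hd : 1 + 2 * x + ρ = d at r4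
  field_simp
  subst hA hB ha hb hc hd
  ring

/-- The branch-cut integral is a combination of three complete integrals with modulus `4x`. -/
lemma cutIntegral_eq (hx : 0 < x) (hw : 0 < w) (h : 4 * x + w ^ 2 < 1) :
    cutIntegral x w =
      2 * (1 + 4 * x) / (Real.pi * (1 + 4 * x - w ^ 2)) * ellipticPi (4 * x) 0 +
      poleCoeff x w √((2 * x) ^ 2 + w ^ 2) *
        ellipticPi (4 * x) (poleChar x √((2 * x) ^ 2 + w ^ 2)) +
      poleCoeff x w (-√((2 * x) ^ 2 + w ^ 2)) *
        ellipticPi (4 * x) (poleChar x (-√((2 * x) ^ 2 + w ^ 2))) := by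
  have hl1 := poleChar_lt_one hx hw
  have hl2 := poleChar_neg_lt_one hx hw
  have hρ0 := two_mul_lt_sqrt (x := x) hw
  have hρ1 := sqrt_lt_one_sub h
  have hρ2 : √((2 * x) ^ 2 + w ^ 2) ^ 2 = (2 * x) ^ 2 + w ^ 2 := Real.sq_sqrt (by positivity)
  set ρ := √((2 * x) ^ 2 + w ^ 2)
  have hx4 : 4 * x < 1 := by nlinarith
  have hπ := Real.pi_ne_zero
  have hI : Set.uIcc (0 : ℝ) 1 = Set.Icc 0 1 := Set.uIcc_of_le zero_le_one
  have hden {t : ℝ} (ht : t ∈ Set.Icc (-(2 * x)) (2 * x)) : 0 < (2 * x) ^ 2 + w ^ 2 - t ^ 2 := by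
    nlinarith [ht.1, ht.2]
  have hσ : ∀ t ∈ Set.Icc (0 : ℝ) 1, legendreCoord x t ∈ Set.Icc (-(2 * x)) (2 * x) := by
    intro t ht
    have ht2 : t ^ 2 ≤ 1 := by nlinarith [ht.1, ht.2]
    have hp : 0 < 1 + 4 * x * t ^ 2 := by positivity
    rw [legendreCoord]
    constructor
    · rw [le_div_iff₀ hp]
      nlinarith [mul_nonneg hx.le (sq_nonneg t), mul_nonneg (mul_nonneg hx.le hx.le) (sq_nonneg t)]
    · rw [div_le_iff₀ hp]
      nlinarith [mul_nonneg hx.le (sub_nonneg.2 ht2)]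
  set G : ℝ → ℝ := fun t =>
    √((2 * x) ^ 2 - t ^ 2) / (((2 * x) ^ 2 + w ^ 2 - t ^ 2) * √((1 - t) ^ 2 - (2 * x) ^ 2)) with hG
  have hsub := intervalIntegral.integral_comp_mul_deriv'' (a := 0) (b := 1)
    (f := legendreCoord x) (f' := fun t => 8 * x * (1 + 4 * x) * t / (1 + 4 * x * t ^ 2) ^ 2)
    (g := G)
    (fun t _ => (hasDerivAt_legendreCoord hx t).continuousAt.continuousWithinAt)
    (fun t _ => (hasDerivAt_legendreCoord hx t).hasDerivWithinAt)
    (ContinuousOn.div (by fun_prop) (by fun_prop) fun t _ => by positivity)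
    (by
      refine ContinuousOn.mono (s := Set.Icc (-(2 * x)) (2 * x)) ?_ ?_
      · refine ContinuousOn.div (by fun_prop) (by fun_prop) fun t ht => ?_
        exact mul_ne_zero (hden ht).ne' (Real.sqrt_pos.2 (sq_sub_pos hx4 ht)).ne'
      · rintro _ ⟨t, ht, rfl⟩
        exact hσ t (hI ▸ ht))
  have hend0 : legendreCoord x 0 = -(2 * x) := by simp [legendreCoord]
  have hend1 : legendreCoord x 1 = 2 * x := by
    rw [legendreCoord]; field_simp; ring
  rw [hend0, hend1] at hsub
  have e : ∀ t ∈ Set.uIcc (0 : ℝ) 1,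
      (G ∘ legendreCoord x) t * (8 * x * (1 + 4 * x) * t / (1 + 4 * x * t ^ 2) ^ 2) =
      Real.pi * (2 * (1 + 4 * x) / (Real.pi * (1 + 4 * x - w ^ 2))) *
        (1 / √((1 - t ^ 2) * (1 - (4 * x) ^ 2 * t ^ 2)) * (1 / (1 - 0 * t ^ 2))) +
      Real.pi * poleCoeff x w ρ *
        (1 / √((1 - t ^ 2) * (1 - (4 * x) ^ 2 * t ^ 2)) * (1 / (1 - poleChar x ρ * t ^ 2))) +
      Real.pi * poleCoeff x w (-ρ) *
        (1 / √((1 - t ^ 2) * (1 - (4 * x) ^ 2 * t ^ 2)) *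
          (1 / (1 - poleChar x (-ρ) * t ^ 2))) := by
    intro t ht
    rw [hI] at ht
    have ht2 : t ^ 2 ≤ 1 := by nlinarith [ht.1, ht.2]
    have hs := hσ t ht
    have hp : 1 + 4 * x * t ^ 2 ≠ 0 := by positivity
    have hD := hden hs
    have hB := sq_sub_pos hx4 hs
    have hE : 0 < 1 - (4 * x) ^ 2 * t ^ 2 := by nlinarith
    have hpf := legendre_partial_fractions hx hρ0 hρ1 hρ2 ht
    -- the quotient of the two square roots; at `t = 1` both sides vanish
    have hroot : √((2 * x) ^ 2 - legendreCoord x t ^ 2) /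
        √((1 - legendreCoord x t) ^ 2 - (2 * x) ^ 2) =
        4 * x * t * (1 - t ^ 2) * (1 / √((1 - t ^ 2) * (1 - (4 * x) ^ 2 * t ^ 2))) := by
      rw [mul_one_div, ← Real.sqrt_div' _ hB.le, ← Real.sqrt_sq (mul_nonneg (mul_nonneg
        (by positivity) ht.1) (by linarith) : 0 ≤ 4 * x * t * (1 - t ^ 2)),
        ← Real.sqrt_div' _ (mul_nonneg (by linarith) hE.le)]
      congr 1
      have n1 : (2 * x) ^ 2 - legendreCoord x t ^ 2 =
          16 * x ^ 2 * (1 + 4 * x) * t ^ 2 * (1 - t ^ 2) / (1 + 4 * x * t ^ 2) ^ 2 := by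
        rw [legendreCoord]; field_simp; ring
      have n2 : (1 - legendreCoord x t) ^ 2 - (2 * x) ^ 2 =
          (1 + 4 * x) * (1 - (4 * x) ^ 2 * t ^ 2) / (1 + 4 * x * t ^ 2) ^ 2 := by
        rw [legendreCoord]; field_simp; ring
      rw [n1, n2]
      rcases eq_or_ne (1 - t ^ 2) 0 with h0 | h0
      · simp [h0]
      · have hE' := hE.ne'
        have hx1 : 1 + 4 * x ≠ 0 := by positivity
        generalize 1 - (4 * x) ^ 2 * t ^ 2 = E at hE'
        generalize 1 - t ^ 2 = F at h0
        generalize 1 + 4 * x * t ^ 2 = P at hp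
        field_simp
        ring
    have hrat : 8 * x * (1 + 4 * x) * t / (1 + 4 * x * t ^ 2) ^ 2 * (4 * x * t * (1 - t ^ 2)) =
        2 * ((2 * x) ^ 2 - legendreCoord x t ^ 2) := by
      rw [legendreCoord]; field_simp; ring
    calc (G ∘ legendreCoord x) t * (8 * x * (1 + 4 * x) * t / (1 + 4 * x * t ^ 2) ^ 2)
        = (√((2 * x) ^ 2 - legendreCoord x t ^ 2) /
          √((1 - legendreCoord x t) ^ 2 - (2 * x) ^ 2)) *
          (8 * x * (1 + 4 * x) * t / (1 + 4 * x * t ^ 2) ^ 2) *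
          (1 / ((2 * x) ^ 2 + w ^ 2 - legendreCoord x t ^ 2)) := by
          simp only [hG, Function.comp, div_eq_mul_inv, mul_inv]
          ring
      _ = (8 * x * (1 + 4 * x) * t / (1 + 4 * x * t ^ 2) ^ 2 * (4 * x * t * (1 - t ^ 2))) *
          (1 / ((2 * x) ^ 2 + w ^ 2 - legendreCoord x t ^ 2)) *
          (1 / √((1 - t ^ 2) * (1 - (4 * x) ^ 2 * t ^ 2))) := by
          rw [hroot]; ring
      _ = 2 * (((2 * x) ^ 2 - legendreCoord x t ^ 2) /
          ((2 * x) ^ 2 + w ^ 2 - legendreCoord x t ^ 2)) *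
          (1 / √((1 - t ^ 2) * (1 - (4 * x) ^ 2 * t ^ 2))) := by
          rw [hrat]; ring
      _ = _ := by
          rw [hpf]; ring
  have hk0 : (0 : ℝ) ≤ 4 * x := by positivity
  rw [cutIntegral, ← hsub, intervalIntegral.integral_congr e, intervalIntegral.integral_add
    (((intervalIntegrable_ellipticPi hk0 hx4 zero_lt_one).const_mul _).add
      ((intervalIntegrable_ellipticPi hk0 hx4 hl1).const_mul _))
    ((intervalIntegrable_ellipticPi hk0 hx4 hl2).const_mul _), intervalIntegral.integral_add
    ((intervalIntegrable_ellipticPi hk0 hx4 zero_lt_one).const_mul _)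
    ((intervalIntegrable_ellipticPi hk0 hx4 hl1).const_mul _),
    intervalIntegral.integral_const_mul, intervalIntegral.integral_const_mul,
    intervalIntegral.integral_const_mul]
  have key (a b c d e f : ℝ) : 1 / Real.pi * (Real.pi * a * b + Real.pi * c * d + Real.pi * e * f)
      = a * b + c * d + e * f := by field_simp
  exact key _ _ _ _ _ _

end reduction

/-! ### Algebraicity of the coefficients, moduli and characteristics -/

/-- The contribution of the pole at `s = √(4x² + w²)` to the generating function. -/
noncomputable def polePart (x w : ℝ) : ℝ :=
  w / (√((2 * x) ^ 2 + w ^ 2) * √((1 - √((2 * x) ^ 2 + w ^ 2)) ^ 2 - (2 * x) ^ 2))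

section substitution

variable {D : Set (ℝ × ℝ)} {X W : ℝ × ℝ → ℝ}

lemma IsAlgebraicFunOn.sqrt_sq_add_sq (hX : IsAlgebraicFunOn D X) (hW : IsAlgebraicFunOn D W)
    (hD : ∀ p ∈ D, (X p, W p) ∈ regionXW) :
    IsAlgebraicFunOn D (fun p => √((2 * X p) ^ 2 + W p ^ 2)) :=
  (((const 2).mul hX).pow 2 |>.add (hW.pow 2)).sqrt fun p hp => by
    have := (hD p hp).1
    positivity

lemma isAlgebraicFunOn_polePart (hX : IsAlgebraicFunOn D X) (hW : IsAlgebraicFunOn D W)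
    (hD : ∀ p ∈ D, (X p, W p) ∈ regionXW) :
    IsAlgebraicFunOn D (fun p => polePart (X p) (W p)) := by
  have hρ := hX.sqrt_sq_add_sq hW hD
  have hpos : ∀ p ∈ D, 0 < (1 - √((2 * X p) ^ 2 + W p ^ 2)) ^ 2 - (2 * X p) ^ 2 := fun p hp => by
    obtain ⟨hx, hw, h⟩ := hD p hp
    have h1 := sqrt_lt_one_sub h
    dsimp only at hx hw h1
    nlinarith
  refine hW.div (hρ.mul (IsAlgebraicFunOn.sqrt ((((IsAlgebraicFunOn.const 1).sub hρ).pow 2).sub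
    (((IsAlgebraicFunOn.const 2).mul hX).pow 2)) hpos)) fun p hp => ?_
  obtain ⟨hx, hw, h⟩ := hD p hp
  dsimp only at hx
  exact mul_ne_zero (Real.sqrt_pos.2 (by positivity)).ne' (Real.sqrt_pos.2 (hpos p hp)).ne'

lemma isAlgebraicFunOn_poleChar {R : ℝ × ℝ → ℝ} (hX : IsAlgebraicFunOn D X)
    (hR : IsAlgebraicFunOn D R) (h0 : ∀ p ∈ D, R p + 2 * X p ≠ 0) :
    IsAlgebraicFunOn D (fun p => poleChar (X p) (R p)) :=
  (((IsAlgebraicFunOn.const 4).mul hX).mul (((IsAlgebraicFunOn.const 1).add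
    ((IsAlgebraicFunOn.const 2).mul hX)).sub hR)).div
    (hR.add ((IsAlgebraicFunOn.const 2).mul hX)) h0

lemma isAlgebraicFunOn_poleCoeff {R : ℝ × ℝ → ℝ} (hX : IsAlgebraicFunOn D X)
    (hW : IsAlgebraicFunOn D W) (hR : IsAlgebraicFunOn D R)
    (h0 : ∀ p ∈ D, R p * (R p + 2 * X p) * (1 + 2 * X p - R p) ≠ 0) :
    IsAlgebraicFunOn D (fun p => poleCoeff (X p) (W p) (R p)) :=
  (((hW.pow 2).mul ((IsAlgebraicFunOn.const 1).add
    ((IsAlgebraicFunOn.const 4).mul hX))).neg).div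
    ((IsAlgebraicFunOn.const Real.pi).mul ((hR.mul (hR.add
      ((IsAlgebraicFunOn.const 2).mul hX))).mul (((IsAlgebraicFunOn.const 1).add
      ((IsAlgebraicFunOn.const 2).mul hX)).sub hR)))
    fun p hp => mul_ne_zero Real.pi_ne_zero (h0 p hp)

lemma poleCoeff_ne_zero {x w ρ : ℝ} (hx : 0 < x) (hw : 0 < w)
    (h0 : ρ * (ρ + 2 * x) * (1 + 2 * x - ρ) ≠ 0) : poleCoeff x w ρ ≠ 0 :=
  div_ne_zero (neg_ne_zero.2 (by positivity)) (mul_ne_zero Real.pi_ne_zero h0)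

lemma pole_denominator_ne_zero {x w : ℝ} (hx : 0 < x) (hw : 0 < w) (h : 4 * x + w ^ 2 < 1) :
    √((2 * x) ^ 2 + w ^ 2) * (√((2 * x) ^ 2 + w ^ 2) + 2 * x) *
        (1 + 2 * x - √((2 * x) ^ 2 + w ^ 2)) ≠ 0 ∧
      -√((2 * x) ^ 2 + w ^ 2) * (-√((2 * x) ^ 2 + w ^ 2) + 2 * x) *
        (1 + 2 * x - -√((2 * x) ^ 2 + w ^ 2)) ≠ 0 := by
  have h1 := two_mul_lt_sqrt (x := x) hw
  have h2 := sqrt_lt_one_sub h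
  refine ⟨mul_ne_zero (mul_ne_zero ?_ ?_) ?_, mul_ne_zero (mul_ne_zero ?_ ?_) ?_⟩ <;>
    · intro h3
      linarith

/-- Three terms: the integral of the first kind and the two integrals of the third kind with
poles at `s = ±√(4x² + w²)`. -/
lemma isPiCombinationOn_cutIntegral (hX : IsAlgebraicFunOn D X) (hW : IsAlgebraicFunOn D W)
    (hD : ∀ p ∈ D, (X p, W p) ∈ regionXW) (hne : D.Nonempty) :
    IsPiCombinationOn D 3 (fun p => cutIntegral (X p) (W p)) := by
  have hρ := hX.sqrt_sq_add_sq hW hD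
  have hk : IsAlgebraicFunOn D (fun p => 4 * X p) := (IsAlgebraicFunOn.const 4).mul hX
  have hden {p : ℝ × ℝ} (hp : p ∈ D) : 0 < 1 + 4 * X p - W p ^ 2 := by
    obtain ⟨hx, hw, h⟩ := hD p hp
    dsimp only at hx h
    linarith
  have hden1 {p : ℝ × ℝ} (hp : p ∈ D) :=
    pole_denominator_ne_zero (hD p hp).1 (hD p hp).2.1 (hD p hp).2.2
  have h0 : IsAlgebraicFunOn D
      (fun p => 2 * (1 + 4 * X p) / (Real.pi * (1 + 4 * X p - W p ^ 2))) :=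
    ((IsAlgebraicFunOn.const 2).mul ((IsAlgebraicFunOn.const 1).add hk)).div
      ((IsAlgebraicFunOn.const Real.pi).mul (((IsAlgebraicFunOn.const 1).add hk).sub (hW.pow 2)))
      fun p hp => mul_ne_zero Real.pi_ne_zero (hden hp).ne'
  obtain ⟨q, hq⟩ := hne
  refine ⟨![fun p => 2 * (1 + 4 * X p) / (Real.pi * (1 + 4 * X p - W p ^ 2)),
      fun p => poleCoeff (X p) (W p) √((2 * X p) ^ 2 + W p ^ 2),
      fun p => poleCoeff (X p) (W p) (-√((2 * X p) ^ 2 + W p ^ 2))],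
    fun _ p => 4 * X p,
    ![fun _ => 0, fun p => poleChar (X p) √((2 * X p) ^ 2 + W p ^ 2),
      fun p => poleChar (X p) (-√((2 * X p) ^ 2 + W p ^ 2))], ?_, ?_, ?_, ?_⟩
  · rw [Fin.forall_fin_succ, Fin.forall_fin_two]
    refine ⟨⟨h0, hk, .const 0⟩, ⟨isAlgebraicFunOn_poleCoeff hX hW hρ fun p hp => (hden1 hp).1, hk,
      isAlgebraicFunOn_poleChar hX hρ fun p hp =>
        right_ne_zero_of_mul (left_ne_zero_of_mul (hden1 hp).1)⟩,
      ⟨isAlgebraicFunOn_poleCoeff hX hW hρ.neg fun p hp => (hden1 hp).2, hk,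
      isAlgebraicFunOn_poleChar hX hρ.neg fun p hp =>
        right_ne_zero_of_mul (left_ne_zero_of_mul (hden1 hp).2)⟩⟩
  · obtain ⟨hx, hw, -⟩ := hD q hq
    rw [Fin.forall_fin_succ, Fin.forall_fin_two]
    refine ⟨⟨q, hq, ?_⟩, ⟨q, hq, poleCoeff_ne_zero hx hw (hden1 hq).1⟩,
      ⟨q, hq, poleCoeff_ne_zero hx hw (hden1 hq).2⟩⟩
    have := hden hq
    dsimp only at hx
    have := Real.pi_pos
    exact (by positivity : 0 < 2 * (1 + 4 * X q) / (Real.pi * (1 + 4 * X q - W q ^ 2))).ne'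
  · intro i p hp
    obtain ⟨hx, hw, h⟩ := hD p hp
    have hl1 := poleChar_lt_one hx hw
    have hl2 := poleChar_neg_lt_one hx hw
    dsimp only at hx hw h hl1 hl2
    refine ⟨by positivity, by nlinarith, ?_⟩
    revert i
    rw [Fin.forall_fin_succ, Fin.forall_fin_two]
    exact ⟨zero_lt_one, hl1, hl2⟩
  · intro p hp
    obtain ⟨hx, hw, h⟩ := hD p hp
    rw [Fin.sum_univ_three]
    exact cutIntegral_eq hx hw h

end substitution

/-! ### The three parts of the theorem -/

theorem theorem1 :
    -- the branch-cut part is a combination of at most four `Π`-terms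
    (∃ m : ℕ, m ≤ 4 ∧ ∃ f : ℝ × ℝ → ℝ, IsPiCombinationOn regionXW m f ∧
      ∀ p ∈ regionXW, branchCutPart p.1 p.2 = (f p : ℂ)) ∧
    -- the generating function differs from the branch-cut part by an algebraic function
    (∃ a : ℝ × ℝ → ℝ, IsAlgebraicFunOn regionXW a ∧
      ∀ p ∈ regionXW, Summable (alphaTerm p.2 (p.1 ^ 2)) ∧
        (alphaGF p.2 (p.1 ^ 2) : ℂ) = (a p : ℂ) + branchCutPart p.1 p.2) ∧
    -- the generating function in its own variables `(w, z)`
    (∃ a : ℝ × ℝ → ℝ, IsAlgebraicFunOn regionWZ a ∧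
      ∃ m : ℕ, m ≤ 4 ∧ ∃ f : ℝ × ℝ → ℝ, IsPiCombinationOn regionWZ m f ∧
        ∀ q ∈ regionWZ, Summable (alphaTerm q.1 q.2) ∧ alphaGF q.1 q.2 = a q + f q) := by
  have hcut : ∀ p ∈ regionXW, branchCutPart p.1 p.2 = (cutIntegral p.1 p.2 : ℂ) := by
    rintro p ⟨hx, hw, h⟩
    exact branchCutPart_eq hx hw (by nlinarith)
  have hsum : ∀ p ∈ regionXW, HasSum (alphaTerm p.2 (p.1 ^ 2))
      (polePart p.1 p.2 + cutIntegral p.1 p.2) := by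
    rintro p ⟨hx, hw, h⟩
    have := hasSum_alphaTerm hx hw h
    rwa [mean_inv_sqrt_sub hx hw h] at this
  have hsqrt : IsAlgebraicFunOn regionWZ (fun q => √q.2) :=
    IsAlgebraicFunOn.snd.sqrt fun q hq => hq.2.1
  have hWZ : ∀ q ∈ regionWZ, (√q.2, q.1) ∈ regionXW := fun q hq =>
    ⟨Real.sqrt_pos.2 hq.2.1, hq.1, hq.2.2⟩
  refine ⟨⟨3, by norm_num, fun p => cutIntegral p.1 p.2, ?_, hcut⟩,
    ⟨fun p => polePart p.1 p.2, ?_, fun p hp => ⟨(hsum p hp).summable, ?_⟩⟩,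
    ⟨fun q => polePart √q.2 q.1, ?_, 3, by norm_num, fun q => cutIntegral √q.2 q.1, ?_,
      fun q hq => ?_⟩⟩
  · refine isPiCombinationOn_cutIntegral .fst .snd (fun p hp => hp) ⟨(1 / 8, 1 / 2), ?_⟩
    norm_num [regionXW]
  · exact isAlgebraicFunOn_polePart .fst .snd fun p hp => hp
  · rw [alphaGF, (hsum p hp).tsum_eq, hcut p hp]
    push_cast
    rfl
  · exact isAlgebraicFunOn_polePart hsqrt .fst hWZ
  · refine isPiCombinationOn_cutIntegral hsqrt .fst hWZ ⟨(1 / 2, (1 / 8) ^ 2), ?_⟩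
    rw [regionWZ, Set.mem_ofPred_eq, Real.sqrt_sq (by norm_num)]
    norm_num
  · have h := hsum _ (hWZ q hq)
    simp only [Real.sq_sqrt hq.2.1.le] at h
    exact ⟨h.summable, h.tsum_eq⟩
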